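/- **Theorem (time complexity, threshold 1).** Consider the critical binary Galton–Watson process, in which every node $v$ draws an independent fair bit $b_v$; if $b_v=1$ the node has a left and a right child, and if $b_v=0$ it is a leaf. It is simulated by the following parallel algorithm with threshold $t$. Each thread owns two lists $lds_1$ and $lds_2$ and, as long as $lds_1$ is not empty, repeats: pop a node (from $lds_2$ if that is nonempty, otherwise from $lds_1$), draw its bit, and, if the bit is $1$, create its two children and push them one after the other, into $lds_1$ if $|lds_1|<t$ and into $lds_2$ otherwise; whenever $|lds_2|$ reaches $t$, a new thread is started whose $lds_1$ is the current $lds_2$, and $lds_2$ is emptied. Initially there is one thread, whose $lds_1$ contains just the root. In the fully parallel model every thread performs one iteration of its loop per unit of time, and the running time $T$ is the time after which the last node is treated (the root is treated at time $0$). The size of a binary tree is the total number $n$ of its nodes, leaves included, so that $n$ is odd; its height is the largest distance of a node from the root. Let the threshold be $t=1$. 1. Whenever the process stops after generating exactly $n$ nodes, these nodes form a binary tree of size $n$, and $T$ equals the height of this tree. 2. Conditionally on the size being $n$, the generated tree is uniformly distributed over all binary trees of size $n$. Let $T_n$ denote $T$ conditioned on size $n$, and let $n\to\infty$ through the odd integers.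 3. $T_n$, normalized by the factor $\frac{1}{2\sqrt{\pi n}}$, converges in distribution to a (scaled) Theta law: $$\mathbb P\Big(\frac{T_n}{2\sqrt{\pi n}}\le x\Big)\longrightarrow 1-\Theta\big(\sqrt{2\pi}\,x\big)\quad(x>0),\qquad \Theta(y)=\sum_{j\ge 1}\big(4j^2y^2-2\big)e^{-j^2y^2},$$ and the limit is $0$ for $x\le 0$. 4. $\mathbb E(T_n)\sim\sqrt{2\pi n}$; in particular the expected running time is of order $\sqrt{\pi n}$. (In terms of the number $m=(n-1)/2$ of internal nodes, $\mathbb E(T_n)\sim 2\sqrt{\pi m}$, and $T_n/(2\sqrt{\pi m})$ converges in distribution to the Theta law scaled to have mean $1$.) -/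

import Mathlib

open MeasureTheory ProbabilityTheory Filter Topology Asymptotics

namespace ParallelGW

/-- A node of the genealogy, named by the path from the root to it: `[]` is the root, and the two
children of `v` are `v ++ [false]` and `v ++ [true]`. The level of `v` is `v.length`. -/
abbrev Node := List Bool

/-- The random bits: `ω v` is the bit that is drawn when the node `v` is processed. -/
abbrev Bits := Node → Bool

/-- The probability measure under which all bits are independent and fair. -/
noncomputable def coinMeasure : Measure Bits :=
  Measure.infinitePi fun _ : Node => (PMF.uniformOfFintype Bool).toMeasure

/-- The local state of a thread: its two linear data structures of nodes still to be processed. -/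
structure Thread where
  lds1 : List Node
  lds2 : List Node

/-- The node that the thread pops in the next iteration of its loop (from `lds2` if `lds2` is
nonempty, from `lds1` otherwise) and what remains of its data structures; `none` if the loop is
over, that is, if `lds1` is empty. -/
def Thread.pop : Thread → Option (Node × Thread)
  | ⟨[], _⟩ => none
  | ⟨v :: l₁, []⟩ => some (v, ⟨l₁, []⟩)
  | ⟨w :: l₁, v :: l₂⟩ => some (v, ⟨w :: l₁, l₂⟩)

/-- With threshold `t`, push the new node `v`: into `lds1` as long as the size of `lds1` is below
`t`, into `lds2` otherwise; if `lds2` then reaches size `t`, a new thread is started on the content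
of `lds2`, and `lds2` becomes empty. The second component collects the new threads. -/
def push (t : ℕ) (s : Thread × List Thread) (v : Node) : Thread × List Thread :=
  if s.1.lds1.length < t then
    (⟨v :: s.1.lds1, s.1.lds2⟩, s.2)
  else if t ≤ (v :: s.1.lds2).length then
    (⟨s.1.lds1, []⟩, ⟨v :: s.1.lds2, []⟩ :: s.2)
  else
    (⟨s.1.lds1, v :: s.1.lds2⟩, s.2)

/-- One iteration of the loop of a thread: pop a node and draw its bit; if the bit is `1`, create
the two children of the node and push them. The result is the thread together with the threads that
it has just started, or no thread at all if its loop was over. -/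
def Thread.iterate (t : ℕ) (ω : Bits) (th : Thread) : List Thread :=
  match th.pop with
  | none => []
  | some (v, rest) =>
    if ω v = true then
      let s := push t (push t (rest, []) (v ++ [false])) (v ++ [true])
      s.1 :: s.2
    else [rest]

/-- The fully parallel model: in every unit of time each thread that is present carries out one
iteration of its loop. `threads t ω k` is the collection of threads after `k` units of time; at the
beginning there is one thread, and its `lds1` contains just the root. -/
def threads (t : ℕ) (ω : Bits) : ℕ → List Thread
  | 0 => [⟨[[]], []⟩]
  | k + 1 => (threads t ω k).flatMap (Thread.iterate t ω)

/-- The nodes that are treated after exactly `k` units of time (the root is treated after `0`). -/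
def treatedAt (t : ℕ) (ω : Bits) (k : ℕ) : List Node :=
  (threads t ω k).filterMap fun th => th.pop.map Prod.fst

/-- The set of all nodes that a run generates and treats. -/
def generated (t : ℕ) (ω : Bits) : Set Node :=
  {v | ∃ k, v ∈ treatedAt t ω k}

/-- The running time of a run that stops: the time after which the last node is treated. -/
noncomputable def runningTime (t : ℕ) (ω : Bits) : ℕ :=
  sSup {k | treatedAt t ω k ≠ []}

/-- The law of the bits, given that the run stops after having generated exactly `n` nodes. -/
noncomputable def condMeasure (t n : ℕ) : Measure Bits :=
  ProbabilityTheory.cond coinMeasure {ω | (generated t ω).encard = n}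

/-- Rooted plane binary trees (every node has no child or has a left and a right child): the
constructor `nil` is the tree whose only node is a leaf. -/
abbrev BinTree := BinaryTree Unit

/-- The size of a binary tree: the number of all its nodes, internal nodes and leaves. -/
def size (τ : BinTree) : ℕ := τ.numNodes + τ.numLeaves

/-- The set of all nodes (internal nodes and leaves) of a binary tree. -/
def nodeSet : BinTree → Set Node
  | .nil => {[]}
  | .node _ l r => {[]} ∪ List.cons false '' nodeSet l ∪ List.cons true '' nodeSet r

/-- The tail function `x ↦ P(X > x)`, for `x > 0`, of the standard Theta law. -/
noncomputable def thetaTail (x : ℝ) : ℝ :=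
  ∑' j : ℕ, (4 * ((j : ℝ) + 1) ^ 2 * x ^ 2 - 2) * Real.exp (-((j : ℝ) + 1) ^ 2 * x ^ 2)

/-- The distribution function of the standard Theta law, a law on the positive reals. -/
noncomputable def thetaCDF (x : ℝ) : ℝ :=
  if 0 < x then 1 - thetaTail x else 0

end ParallelGW

/-!
With threshold `1` every thread owns a single node, so that the threads present after `k` units of
time are the nodes of level `k` (`mem_threads_one`). The run thus explores the Galton–Watson tree
level by level, and its running time is the height. Generating a given tree prescribes one fair bit
for each of its nodes, so all trees of the same size are equally likely
(`condMeasure_real_eq_treeProb`), and what remains is the limit law of the height of a uniform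
binary tree with `m` internal nodes.

This law follows from an exact computation for a simpler statistic. The *left height*, the largest
number of left steps on a path to a leaf, corresponds to the height of a Dyck path under the
rotation correspondence. The trees of left height less than `H` are counted by the paths in a strip,
hence by the reflection principle (`stripCount_eq_wrappedChoose`). The proportion of the other trees
is a sum of second differences of binomial coefficients (`stripCount_div_catalan`), which converges
term by term to the tail of the Theta law and has Gaussian bounds (`tendsto_leftTail`,
`leftTail_le`).

The height is close to twice the left height. Indeed, the number of pairs of a tree and a leaf in it
that is reached by a given path depends on the length of the path only (`sum_leafWeight_congr`), so
that on the path to a typical leaf the left and right steps behave like fair coin tosses; an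
exponential Markov inequality (`treeProb_exists_leafSteps_le`) controls all leaves simultaneously.
This gives the limit law (`tendsto_heightTail`). A path to a deepest leaf consists of left steps and
right steps, so the Gaussian bounds carry over to the height by symmetry (`heightTail_le`), and
dominated convergence gives the mean. The mean `√π` of the Theta law comes from an explicit
antiderivative and the functional equation of the Jacobi theta function (`integral_thetaTail`).
-/

namespace ParallelGW

open BinaryTree

/-! ### Binary trees of bounded left height -/

/-- The left height of a binary tree: the largest number of left steps on a path from the root to a
leaf. Under the rotation correspondence it is the height of the associated plane forest. -/
def leftHeight : BinTree → ℕ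
  | .nil => 0
  | .node _ l r => max (leftHeight l + 1) (leftHeight r)

/-- The number of binary trees with `m` internal nodes whose left height is less than `H`. -/
def stripCount (H m : ℕ) : ℕ :=
  ((treesOfNumNodesEq m).filter fun τ => leftHeight τ < H).card

theorem sum_treesOfNumNodesEq_succ {R : Type*} [AddCommMonoid R] (m : ℕ) (f : BinTree → R) :
    ∑ τ ∈ treesOfNumNodesEq (m + 1), f τ =
      ∑ ij ∈ Finset.HasAntidiagonal.antidiagonal m,
        ∑ l ∈ treesOfNumNodesEq ij.1, ∑ r ∈ treesOfNumNodesEq ij.2, f (.node () l r) := by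
  rw [treesOfNumNodesEq_succ, Finset.sum_biUnion]
  · refine Finset.sum_congr rfl fun ij _ => ?_
    rw [pairwiseNode, Finset.sum_map, Finset.sum_product]
    rfl
  · intro i hi j hj hij
    refine Finset.disjoint_left.mpr fun τ h1 h2 => hij ?_
    simp only [pairwiseNode, Finset.mem_map, Finset.mem_product, mem_treesOfNumNodesEq] at h1 h2
    obtain ⟨⟨a, b⟩, ⟨ha, hb⟩, rfl⟩ := h1
    obtain ⟨⟨c, d⟩, ⟨hc, hd⟩, h⟩ := h2
    obtain ⟨-, rfl, rfl⟩ := node.inj h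
    exact Prod.ext (ha.symm.trans hc) (hb.symm.trans hd)

theorem stripCount_eq_sum (H m : ℕ) :
    (stripCount H m : ℝ) = ∑ τ ∈ treesOfNumNodesEq m, if leftHeight τ < H then 1 else 0 := by
  simp [stripCount]

theorem stripCount_zero_left (m : ℕ) : stripCount 0 m = 0 := by
  simp [stripCount]

theorem stripCount_zero_right (H : ℕ) : stripCount (H + 1) 0 = 1 := by
  simp [stripCount, leftHeight, Finset.filter_singleton]

/-- The left subtree of a tree of left height less than `H + 1` has left height less than `H`, and
for the right subtree the bound is unchanged. -/
theorem stripCount_succ (H m : ℕ) :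
    (stripCount (H + 1) (m + 1) : ℝ) =
      ∑ ij ∈ Finset.HasAntidiagonal.antidiagonal m,
        (stripCount H ij.1 : ℝ) * stripCount (H + 1) ij.2 := by
  rw [stripCount_eq_sum, sum_treesOfNumNodesEq_succ]
  refine Finset.sum_congr rfl fun ij _ => ?_
  rw [stripCount_eq_sum, stripCount_eq_sum, Finset.sum_mul_sum]
  refine Finset.sum_congr rfl fun l _ => Finset.sum_congr rfl fun r _ => ?_
  simp only [leftHeight, max_lt_iff, Nat.add_lt_add_iff_right]
  split_ifs <;> simp_all

/-- The generating function of the binary trees of left height less than `H`. -/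
noncomputable def stripSeries (H : ℕ) : PowerSeries ℝ :=
  PowerSeries.mk fun m => (stripCount H m : ℝ)

theorem stripSeries_zero : stripSeries 0 = 0 := by
  ext m; simp [stripSeries, stripCount_zero_left]

theorem stripSeries_succ (H : ℕ) :
    stripSeries (H + 1) = 1 + PowerSeries.X * (stripSeries H * stripSeries (H + 1)) := by
  ext m
  cases m with
  | zero => simp [stripSeries, stripCount_zero_right]
  | succ m =>
    rw [map_add, PowerSeries.coeff_succ_X_mul, PowerSeries.coeff_mul]
    simp [stripSeries, stripCount_succ, PowerSeries.coeff_one]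

/-- The generating function of the lattice paths that start at height `a - 1`, stay in the strip
between `0` and `H - 1` and end at `0`, obtained by cutting such a path at its first passages
through lower levels; the variable marks the up-steps. -/
noncomputable def passageSeries (H a : ℕ) : PowerSeries ℝ :=
  ∏ i ∈ Finset.range a, stripSeries (H - i)

theorem passageSeries_succ {H a : ℕ} (ha : a < H) :
    passageSeries H (a + 1) = passageSeries H a + PowerSeries.X * passageSeries H (a + 2) := by
  obtain ⟨d, rfl⟩ := Nat.exists_eq_add_of_lt ha
  have h1 : a + d + 1 - a = d + 1 := by omega
  have h2 : a + d + 1 - (a + 1) = d := by omega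
  simp only [passageSeries, Finset.prod_range_succ, h1, h2]
  linear_combination (∏ i ∈ Finset.range a, stripSeries (a + d + 1 - i)) * stripSeries_succ d

theorem passageSeries_top (H : ℕ) : passageSeries H (H + 1) = 0 := by
  simp [passageSeries, Finset.prod_range_succ, stripSeries_zero]

/-- The binomial coefficient with an integer as lower index, zero outside of `0, …, n`. -/
def intChoose (n : ℕ) : ℤ → ℕ
  | .ofNat k => n.choose k
  | .negSucc _ => 0

theorem intChoose_natCast (n k : ℕ) : intChoose n k = n.choose k := rfl

theorem intChoose_zero (n : ℕ) : intChoose n 0 = 1 := Nat.choose_zero_right n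

theorem intChoose_of_neg {n : ℕ} {k : ℤ} (hk : k < 0) : intChoose n k = 0 := by
  cases k with
  | ofNat k => exact absurd hk (by simp)
  | negSucc k => rfl

theorem intChoose_of_lt {n : ℕ} {k : ℤ} (hk : (n : ℤ) < k) : intChoose n k = 0 := by
  lift k to ℕ using by omega
  exact Nat.choose_eq_zero_of_lt (by exact_mod_cast hk)

theorem intChoose_succ (n : ℕ) (k : ℤ) :
    intChoose (n + 1) k = intChoose n k + intChoose n (k - 1) := by
  rcases lt_trichotomy k 0 with h | rfl | h
  · simp [intChoose_of_neg h, intChoose_of_neg (show k - 1 < 0 by omega)]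
  · rw [intChoose_of_neg (show (0 : ℤ) - 1 < 0 by omega)]
    simp [intChoose_zero]
  · obtain ⟨j, rfl⟩ : ∃ j : ℕ, k = j + 1 := ⟨(k - 1).toNat, by omega⟩
    rw [add_sub_cancel_right, show (j : ℤ) + 1 = ((j + 1 : ℕ) : ℤ) by push_cast; rfl]
    simp only [intChoose_natCast, Nat.choose_succ_succ]
    ring

theorem intChoose_symm (n : ℕ) (k : ℤ) : intChoose n (n - k) = intChoose n k := by
  rcases lt_or_ge k 0 with h | h
  · rw [intChoose_of_neg h, intChoose_of_lt (by omega)]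
  rcases lt_or_ge (n : ℤ) k with h' | h'
  · rw [intChoose_of_lt h', intChoose_of_neg (by omega)]
  lift k to ℕ using h
  rw [show (n : ℤ) - k = ((n - k : ℕ) : ℤ) by omega]
  exact Nat.choose_symm (by omega)

/-- The number of subsets of an `n`-element set whose size is congruent to `i` modulo `N`. -/
noncomputable def wrappedChoose (N n : ℕ) (i : ℤ) : ℝ := ∑' k : ℤ, (intChoose n (i + k * N) : ℝ)

theorem summable_intChoose {N : ℕ} (hN : 0 < N) (n : ℕ) (i : ℤ) :
    Summable fun k : ℤ => (intChoose n (i + k * N) : ℝ) := by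
  refine summable_of_hasFiniteSupport ((Set.finite_Icc (-|i|) (n + |i|)).subset fun k hk => ?_)
  by_contra hk'
  apply hk
  change (intChoose n (i + k * N) : ℝ) = 0
  have hN' : (1 : ℤ) ≤ N := by exact_mod_cast hN
  have h1 := neg_abs_le i
  have h2 := le_abs_self i
  have h3 := abs_nonneg i
  rw [Set.mem_Icc, not_and_or, not_le, not_le] at hk'
  rcases hk' with h | h
  · rw [intChoose_of_neg (by nlinarith), Nat.cast_zero]
  · rw [intChoose_of_lt (by nlinarith), Nat.cast_zero]

theorem wrappedChoose_succ {N : ℕ} (hN : 0 < N) (n : ℕ) (i : ℤ) :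
    wrappedChoose N (n + 1) i = wrappedChoose N n i + wrappedChoose N n (i - 1) := by
  rw [wrappedChoose, wrappedChoose, wrappedChoose,
    ← (summable_intChoose hN n i).tsum_add (summable_intChoose hN n (i - 1))]
  refine tsum_congr fun k => ?_
  rw [intChoose_succ, Nat.cast_add, show i + k * N - 1 = i - 1 + k * N by ring]

theorem wrappedChoose_add (N n : ℕ) (i : ℤ) : wrappedChoose N n (i + N) = wrappedChoose N n i := by
  rw [wrappedChoose, wrappedChoose,
    ← (Equiv.addRight (1 : ℤ)).tsum_eq fun k : ℤ => (intChoose n (i + k * N) : ℝ)]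
  refine tsum_congr fun k => ?_
  simp only [Equiv.coe_addRight]
  congr 2
  ring

theorem wrappedChoose_symm (N n : ℕ) (i : ℤ) : wrappedChoose N n (n - i) = wrappedChoose N n i := by
  rw [wrappedChoose, wrappedChoose,
    ← (Equiv.neg ℤ).tsum_eq fun k : ℤ => (intChoose n (i + k * N) : ℝ)]
  refine tsum_congr fun k => ?_
  rw [← intChoose_symm n (i + _)]
  simp only [Equiv.neg_apply]
  congr 2
  ring

theorem wrappedChoose_zero_of_lt {N n : ℕ} (h : n < N) : wrappedChoose N n 0 = 1 := by
  rw [wrappedChoose, tsum_eq_single 0]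
  · simp [intChoose_zero]
  · intro k hk
    rcases lt_or_gt_of_ne hk with h' | h'
    · rw [intChoose_of_neg (by nlinarith), Nat.cast_zero]
    · rw [intChoose_of_lt (by nlinarith), Nat.cast_zero]

theorem wrappedChoose_neg_one_of_lt {N n : ℕ} (h : n + 1 < N) : wrappedChoose N n (-1) = 0 := by
  rw [wrappedChoose]
  refine (tsum_congr fun k => ?_).trans tsum_zero
  rcases le_or_gt k 0 with h' | h'
  · rw [intChoose_of_neg (by nlinarith), Nat.cast_zero]
  · rw [intChoose_of_lt (by nlinarith), Nat.cast_zero]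

/-- The reflection principle for paths confined to a strip: the paths that start at height `a` and
have `j` up-steps satisfy Pascal's recurrence with zero boundary values at the heights `-1` and
`H`, and so does the alternating sum over the reflected end points. -/
theorem coeff_passageSeries (H j a : ℕ) (ha : a ≤ H) (hH : 0 < H) :
    PowerSeries.coeff j (passageSeries H (a + 1)) =
      wrappedChoose (H + 1) (a + 2 * j) j - wrappedChoose (H + 1) (a + 2 * j) (j - 1) := by
  -- the two sums cancel at the upper boundary, by the symmetry of the binomial coefficients
  have htop (j : ℕ) : wrappedChoose (H + 1) (H + 2 * j) j =
      wrappedChoose (H + 1) (H + 2 * j) (j - 1) := by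
    rw [← wrappedChoose_symm (H + 1) _ (j - 1 : ℤ), ← wrappedChoose_add (H + 1) _ (j : ℤ)]
    congr 1
    push_cast
    ring
  induction j generalizing a with
  | zero =>
    induction a with
    | zero =>
      have h0 : passageSeries H 1 = 1 + PowerSeries.X * passageSeries H 2 := by
        simpa [passageSeries] using passageSeries_succ hH
      rw [zero_add, h0]
      have h1 := wrappedChoose_zero_of_lt (N := H + 1) (n := 0) (by omega)
      have h2 := wrappedChoose_neg_one_of_lt (N := H + 1) (n := 0) (by omega)
      simp [h1, h2]
    | succ a ih =>
      rcases ha.eq_or_lt with rfl | ha'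
      · rw [passageSeries_top, htop]; simp
      · rw [passageSeries_succ (by omega), map_add, ih (by omega)]
        have h1 := wrappedChoose_zero_of_lt (N := H + 1) (n := a) (by omega)
        have h2 := wrappedChoose_neg_one_of_lt (N := H + 1) (n := a) (by omega)
        have h3 := wrappedChoose_zero_of_lt (N := H + 1) (n := a + 1) (by omega)
        have h4 := wrappedChoose_neg_one_of_lt (N := H + 1) (n := a + 1) (by omega)
        simp [h1, h2, h3, h4]
  | succ j ihj =>
    induction a with
    | zero =>
      have h0 : passageSeries H 1 = 1 + PowerSeries.X * passageSeries H 2 := by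
        simpa [passageSeries] using passageSeries_succ hH
      rw [zero_add, h0, map_add, PowerSeries.coeff_succ_X_mul, ihj 1 hH]
      -- the same symmetry gives the cancellation at the lower boundary
      have h1 :
          wrappedChoose (H + 1) (1 + 2 * j) (j + 1) = wrappedChoose (H + 1) (1 + 2 * j) j := by
        rw [← wrappedChoose_symm (H + 1) _ (j : ℤ)]
        congr 1
        push_cast
        ring
      rw [show 0 + 2 * (j + 1) = 1 + 2 * j + 1 by ring, wrappedChoose_succ (by omega),
        wrappedChoose_succ (by omega)]
      push_cast
      rw [h1]
      simp [PowerSeries.coeff_one]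
    | succ a ih =>
      rcases ha.eq_or_lt with rfl | ha'
      · rw [passageSeries_top, htop]; simp
      · rw [passageSeries_succ (by omega), map_add, PowerSeries.coeff_succ_X_mul, ih (by omega),
          ihj (a + 2) (by omega), show a + 1 + 2 * (j + 1) = a + 2 * (j + 1) + 1 by ring,
          wrappedChoose_succ (by omega), wrappedChoose_succ (by omega),
          show a + 2 + 2 * j = a + 2 * (j + 1) by ring]
        push_cast
        rw [add_sub_cancel_right]
        ring

theorem stripCount_eq_wrappedChoose {H : ℕ} (hH : 0 < H) (m : ℕ) :
    (stripCount H m : ℝ) =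
      wrappedChoose (H + 1) (2 * m) m - wrappedChoose (H + 1) (2 * m) (m - 1) := by
  have h := coeff_passageSeries H m 0 (Nat.zero_le _) hH
  simpa [passageSeries, stripSeries] using h

/-! ### The exact tail of the left height -/

/-- The ratio of the binomial coefficient at distance `j` from the centre of row `2 * M` to the
central one. -/
noncomputable def centralRatio (M j : ℕ) : ℝ := ((2 * M).choose (M + j) : ℝ) / (2 * M).choose M

theorem centralRatio_zero (M : ℕ) : centralRatio M 0 = 1 := by
  rw [centralRatio, add_zero, div_self]
  exact_mod_cast (Nat.choose_pos (by omega)).ne'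

theorem catalan_pos (m : ℕ) : 0 < catalan m := by
  have h := succ_mul_catalan_eq_centralBinom m
  have := Nat.centralBinom_pos m
  by_contra! h0
  simp_all

theorem centralBinom_succ_eq_mul_catalan (m : ℕ) :
    ((2 * (m + 1)).choose (m + 1) : ℝ) = 2 * (2 * m + 1) * catalan m := by
  have h1 := Nat.succ_mul_centralBinom_succ m
  rw [← succ_mul_catalan_eq_centralBinom m] at h1
  have h2 : (m + 1).centralBinom = 2 * (2 * m + 1) * catalan m :=
    Nat.eq_of_mul_eq_mul_left (Nat.succ_pos m) (h1.trans (by rw [Nat.succ_eq_add_one]; ring))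
  rw [Nat.centralBinom_eq_two_mul_choose] at h2
  exact_mod_cast h2

theorem choose_two_mul_succ_mul (m j : ℕ) :
    ((2 * (m + 1)).choose (m + 1 + j) : ℝ) * ((m + 1 + j) * (m + 1 - j)) =
      (2 * m + 2) * (2 * m + 1) * (2 * m).choose (m + j) := by
  rcases lt_or_ge (m + 1) j with h | h
  · rw [Nat.choose_eq_zero_of_lt (by omega), Nat.choose_eq_zero_of_lt (by omega)]
    simp
  · have h1 := Nat.add_one_mul_choose_eq (2 * m + 1) (m + j)
    have h2 := Nat.choose_mul_succ_eq (2 * m) (m + j)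
    have h3 : 2 * m + 1 - (m + j) + j = m + 1 := by omega
    generalize 2 * m + 1 - (m + j) = d at h2 h3
    rw [show 2 * m + 1 + 1 = 2 * (m + 1) by ring, show m + j + 1 = m + 1 + j by ring] at h1
    have h1' : (2 * (m + 1) : ℝ) * (2 * m + 1).choose (m + j) =
      (2 * (m + 1)).choose (m + 1 + j) * (m + 1 + j) := by exact_mod_cast h1
    have h2' : ((2 * m).choose (m + j) : ℝ) * (2 * m + 1) = (2 * m + 1).choose (m + j) * d := by
      exact_mod_cast h2
    have h3' : (d : ℝ) + j = m + 1 := by exact_mod_cast h3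
    have h4 : (d : ℝ) = m + 1 - j := by linarith
    rw [h4] at h2'
    linear_combination (-(m + 1 - j : ℝ)) * h1' - (2 * m + 2) * h2'

/-- The second difference of the binomial coefficients of row `2 * m`, relative to the Catalan
number, in terms of row `2 * (m + 1)`. -/
theorem intChoose_second_difference (m j : ℕ) :
    (intChoose (2 * m) (m + j + 1) : ℝ) + intChoose (2 * m) (m + j - 1)
        - 2 * intChoose (2 * m) (m + j) =
      catalan m * ((4 * (j : ℝ) ^ 2 / (m + 1 : ℕ) - 2) * centralRatio (m + 1) j) := by
  have hB : ((2 * (m + 1)).choose (m + 1 + j) : ℝ) = intChoose (2 * m) (m + j + 1)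
      + 2 * intChoose (2 * m) (m + j) + intChoose (2 * m) (m + j - 1) := by
    rw [← intChoose_natCast, show 2 * (m + 1) = 2 * m + 1 + 1 by ring, intChoose_succ,
      intChoose_succ, intChoose_succ]
    push_cast
    rw [show (m : ℤ) + 1 + j - 1 = m + j by ring, show (m : ℤ) + 1 + j = m + j + 1 by ring]
    ring
  have h1 := choose_two_mul_succ_mul m j
  have h2 := centralBinom_succ_eq_mul_catalan m
  have h3 : (intChoose (2 * m) (m + j) : ℝ) = (2 * m).choose (m + j) := by
    rw [← intChoose_natCast]; push_cast; rfl
  have hc : (catalan m : ℝ) ≠ 0 := by exact_mod_cast (catalan_pos m).ne'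
  have hm : (m + 1 : ℝ) ≠ 0 := by positivity
  have hm2 : (2 * m + 1 : ℝ) ≠ 0 := by positivity
  rw [centralRatio, h2, show (intChoose (2 * m) (m + j + 1) : ℝ) + intChoose (2 * m) (m + j - 1)
        - 2 * intChoose (2 * m) (m + j) = ((2 * (m + 1)).choose (m + 1 + j) : ℝ)
        - 4 * (2 * m).choose (m + j) by rw [hB, ← h3]; ring]
  push_cast
  field_simp
  linear_combination (4 : ℝ) * h1

/-- In the sum over the reflected end points, the term of index `0` counts all trees, and the terms
of indices `k` and `-k` combine to a second difference. -/
theorem stripCount_div_catalan {H : ℕ} (hH : 0 < H) (m : ℕ) :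
    1 - (stripCount H m : ℝ) / catalan m =
      ∑' k : ℕ, (4 * (((k + 1) * (H + 1) : ℕ) : ℝ) ^ 2 / (m + 1 : ℕ) - 2) *
        centralRatio (m + 1) ((k + 1) * (H + 1)) := by
  have hs1 := summable_intChoose (N := H + 1) (by omega) (2 * m) m
  have hs2 := summable_intChoose (N := H + 1) (by omega) (2 * m) (m - 1)
  set g : ℤ → ℝ := fun k => (intChoose (2 * m) (m + k * (H + 1 : ℕ)) : ℝ) -
    intChoose (2 * m) (m - 1 + k * (H + 1 : ℕ)) with hg
  have hgs : Summable g := hs1.sub hs2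
  have hcount : (stripCount H m : ℝ) = ∑' k, g k := by
    rw [stripCount_eq_wrappedChoose hH, wrappedChoose, wrappedChoose, hs1.tsum_sub hs2]
  have hc : (catalan m : ℝ) ≠ 0 := by exact_mod_cast (catalan_pos m).ne'
  have hg0 : g 0 = catalan m := by
    have h1 := intChoose_second_difference m 0
    have h2 := intChoose_symm (2 * m) (m + 1)
    rw [show ((2 * m : ℕ) : ℤ) - (m + 1) = m - 1 by push_cast; ring] at h2
    simp only [centralRatio_zero, Nat.cast_zero, add_zero, ← h2] at h1
    simp only [hg, zero_mul, add_zero]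
    rw [h2] at h1 ⊢
    norm_num at h1
    linarith
  have hpair (k : ℕ) : g ((k + 1 : ℕ) : ℤ) + g (-((k + 1 : ℕ) : ℤ)) = -(catalan m *
      ((4 * (((k + 1) * (H + 1) : ℕ) : ℝ) ^ 2 / (m + 1 : ℕ) - 2) *
        centralRatio (m + 1) ((k + 1) * (H + 1)))) := by
    rw [← intChoose_second_difference]
    simp only [hg]
    rw [← intChoose_symm (2 * m) (m + -((k + 1 : ℕ) : ℤ) * (H + 1 : ℕ)),
      ← intChoose_symm (2 * m) (m - 1 + -((k + 1 : ℕ) : ℤ) * (H + 1 : ℕ))]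
    generalize hj : (k + 1) * (H + 1) = j
    have hj' : ((k + 1 : ℕ) : ℤ) * (H + 1 : ℕ) = j := by exact_mod_cast hj
    rw [neg_mul, hj']
    push_cast
    rw [show (2 * m : ℤ) - (m + -j) = m + j by ring,
      show (2 * m : ℤ) - (m - 1 + -j) = m + j + 1 by ring, show (m - 1 + j : ℤ) = m + j - 1 by ring]
    ring
  have hsum : (stripCount H m : ℝ) = catalan m + ∑' k : ℕ, -(catalan m *
      ((4 * (((k + 1) * (H + 1) : ℕ) : ℝ) ^ 2 / (m + 1 : ℕ) - 2) *
        centralRatio (m + 1) ((k + 1) * (H + 1)))) := by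
    have h1 := tsum_nat_add_neg hgs
    rw [hgs.nat_add_neg.tsum_eq_zero_add] at h1
    rw [← tsum_congr hpair, hcount, ← hg0]
    simp only [Nat.cast_zero, neg_zero] at h1
    linarith
  rw [hsum, tsum_neg, tsum_mul_left]
  field_simp
  ring

/-! ### Gaussian estimates for central binomial coefficients -/

theorem centralRatio_nonneg (M j : ℕ) : 0 ≤ centralRatio M j := by
  rw [centralRatio]; positivity

theorem centralRatio_of_lt {M j : ℕ} (h : M < j) : centralRatio M j = 0 := by
  rw [centralRatio, Nat.choose_eq_zero_of_lt (by omega)]; simp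

theorem centralRatio_succ (M j : ℕ) :
    centralRatio M (j + 1) * (M + j + 1) = centralRatio M j * (M - j) := by
  rcases lt_or_ge M j with h | h
  · rw [centralRatio_of_lt h, centralRatio_of_lt (by omega)]; simp
  have h1 := Nat.choose_succ_right_eq (2 * M) (M + j)
  rw [show 2 * M - (M + j) = M - j by omega] at h1
  have h2 : ((2 * M).choose (M + j + 1) : ℝ) * (M + j + 1) = (2 * M).choose (M + j) * (M - j) := by
    rw [← Nat.cast_sub h]
    exact_mod_cast h1
  rw [centralRatio, centralRatio, ← add_assoc, div_mul_eq_mul_div, div_mul_eq_mul_div, h2]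

/-- Each factor `(M - i) / (M + i + 1)` of the ratio is estimated by `1 + x ≤ exp x`; the odd
numbers `2 * i + 1` add up to `j ^ 2`. -/
theorem centralRatio_le_exp_of_le {M j J : ℕ} (hj : j ≤ J) (hJ : J ≤ M) (hM : 0 < M) :
    centralRatio M j ≤ Real.exp (-(j : ℝ) ^ 2 / (M + J)) := by
  have hM' : (0 : ℝ) < M := by exact_mod_cast hM
  induction j with
  | zero => simp [centralRatio_zero]
  | succ j ih =>
    have hjJ : (j : ℝ) + 1 ≤ J := by exact_mod_cast hj
    have hJM : (J : ℝ) ≤ M := by exact_mod_cast hJ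
    have h1 : centralRatio M (j + 1) = centralRatio M j * ((M - j) / (M + j + 1)) := by
      rw [← mul_div_assoc, ← centralRatio_succ]
      field_simp
    have h2 : ((M : ℝ) - j) / (M + j + 1) ≤ Real.exp (-(2 * j + 1) / (M + J)) := by
      calc ((M : ℝ) - j) / (M + j + 1) = -(2 * j + 1) / (M + j + 1) + 1 := by field_simp; ring
        _ ≤ -(2 * j + 1) / (M + J) + 1 := by
          rw [neg_div, neg_div]
          have : (2 * j + 1 : ℝ) / (M + J) ≤ (2 * j + 1) / (M + j + 1) :=
            div_le_div_of_nonneg_left (by positivity) (by positivity) (by linarith)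
          linarith
        _ ≤ _ := Real.add_one_le_exp _
    rw [h1]
    calc _ ≤ Real.exp (-(j : ℝ) ^ 2 / (M + J)) * Real.exp (-(2 * j + 1) / (M + J)) :=
          mul_le_mul (ih (by omega)) h2 (div_nonneg (by linarith) (by positivity))
            (Real.exp_pos _).le
      _ = _ := by rw [← Real.exp_add]; congr 1; push_cast; ring

theorem centralRatio_le_exp {M : ℕ} (hM : 0 < M) (j : ℕ) :
    centralRatio M j ≤ Real.exp (-(j : ℝ) ^ 2 / (2 * M)) := by
  rcases lt_or_ge M j with h | h
  · rw [centralRatio_of_lt h]; positivity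
  · convert centralRatio_le_exp_of_le h le_rfl hM using 2
    ring

theorem exp_le_centralRatio {M j J : ℕ} (hj : j ≤ J) (hJ : J < M) :
    Real.exp (-(j : ℝ) ^ 2 / (M - J)) ≤ centralRatio M j := by
  have hJM : (J : ℝ) < M := by exact_mod_cast hJ
  induction j with
  | zero => simp [centralRatio_zero]
  | succ j ih =>
    have hjJ : (j : ℝ) + 1 ≤ J := by exact_mod_cast hj
    have h0 : (0 : ℝ) < M - J := by linarith
    have h0' : (0 : ℝ) < M - j := by linarith
    have h1 : centralRatio M (j + 1) = centralRatio M j * ((M - j) / (M + j + 1)) := by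
      rw [← mul_div_assoc, ← centralRatio_succ]
      field_simp
    have h2 : Real.exp (-(2 * j + 1) / (M - J)) ≤ ((M : ℝ) - j) / (M + j + 1) := by
      rw [neg_div, Real.exp_neg, ← inv_div ((M : ℝ) + j + 1)]
      refine inv_anti₀ (show (0 : ℝ) < (M + j + 1) / (M - j) from div_pos (by positivity) h0') ?_
      calc ((M : ℝ) + j + 1) / (M - j) = (2 * j + 1) / (M - j) + 1 := by field_simp; ring
        _ ≤ (2 * j + 1) / (M - J) + 1 := by gcongr; linarith
        _ ≤ _ := Real.add_one_le_exp _
    rw [h1]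
    calc _ = Real.exp (-(j : ℝ) ^ 2 / (M - J)) * Real.exp (-(2 * j + 1) / (M - J)) := by
          rw [← Real.exp_add]; congr 1; push_cast; ring
      _ ≤ _ := mul_le_mul (ih (by omega)) h2 (Real.exp_pos _).le (centralRatio_nonneg _ _)

theorem tendsto_centralRatio {j : ℕ → ℕ} {y : ℝ}
    (hj : Tendsto (fun M : ℕ => (j M : ℝ) / √(M : ℝ)) atTop (𝓝 y)) :
    Tendsto (fun M : ℕ => centralRatio M (j M)) atTop (𝓝 (Real.exp (-y ^ 2))) := by
  have hsq : Tendsto (fun M : ℕ => √(M : ℝ)) atTop atTop :=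
    Real.tendsto_sqrt_atTop.comp tendsto_natCast_atTop_atTop
  have hr : Tendsto (fun M : ℕ => (j M : ℝ) / M) atTop (𝓝 0) := by
    have := hj.mul hsq.inv_tendsto_atTop
    rw [mul_zero] at this
    refine this.congr' ?_
    filter_upwards [eventually_gt_atTop 0] with M hM
    have : (0 : ℝ) < M := by exact_mod_cast hM
    simp only [Pi.inv_apply]
    rw [← div_eq_mul_inv, div_div, Real.mul_self_sqrt this.le]
  have hlim (c : ℝ) : Tendsto (fun M : ℕ => Real.exp (-(j M : ℝ) ^ 2 / (M + c * j M))) atTop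
      (𝓝 (Real.exp (-y ^ 2))) := by
    have h1 : Tendsto (fun M : ℕ => -((j M : ℝ) / √(M : ℝ)) ^ 2 / (1 + c * ((j M : ℝ) / M))) atTop
        (𝓝 (-y ^ 2 / (1 + c * 0))) := ((hj.pow 2).neg).div ((hr.const_mul c).const_add 1) (by simp)
    rw [mul_zero, add_zero, div_one] at h1
    refine (Real.continuous_exp.tendsto _).comp (h1.congr' ?_)
    filter_upwards [eventually_gt_atTop 0] with M hM
    have : (0 : ℝ) < M := by exact_mod_cast hM
    rw [div_pow, Real.sq_sqrt this.le, ← neg_div, div_div]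
    congr 1
    field_simp
  have hlt : ∀ᶠ M : ℕ in atTop, j M < M := by
    filter_upwards [hr.eventually_lt_const one_pos, eventually_gt_atTop 0] with M h1 hM
    have : (0 : ℝ) < M := by exact_mod_cast hM
    rw [div_lt_one this] at h1
    exact_mod_cast h1
  refine tendsto_of_tendsto_of_tendsto_of_le_of_le' (hlim (-1)) (hlim 1) ?_ ?_
  · filter_upwards [hlt] with M hM
    rw [show (M : ℝ) + -1 * j M = M - j M by ring]
    exact exp_le_centralRatio le_rfl hM
  · filter_upwards [hlt, eventually_gt_atTop 0] with M hM h0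
    rw [one_mul]
    exact centralRatio_le_exp_of_le le_rfl hM.le h0

/-! ### The limit law of the left height -/

/-- The fraction of the binary trees with `m` internal nodes whose left height is at least `H`. -/
noncomputable def leftTail (m H : ℕ) : ℝ := 1 - (stripCount H m : ℝ) / catalan m

theorem abs_leftTail_term_le {M : ℕ} (hM : 0 < M) (N k : ℕ) :
    |(4 * (((k + 1) * N : ℕ) : ℝ) ^ 2 / M - 2) * centralRatio M ((k + 1) * N)| ≤
      18 * Real.exp (-(N : ℝ) ^ 2 / (4 * M)) ^ (k + 1) := by
  have hM' : (0 : ℝ) < M := by exact_mod_cast hM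
  set t : ℝ := (((k + 1) * N : ℕ) : ℝ) ^ 2 / M with ht
  have ht0 : 0 ≤ t := by positivity
  have h1 : centralRatio M ((k + 1) * N) ≤ Real.exp (-t / 4) * Real.exp (-t / 4) := by
    refine (centralRatio_le_exp hM _).trans_eq ?_
    rw [← Real.exp_add, ht]
    congr 1
    field_simp
    ring
  have h2 : |4 * (((k + 1) * N : ℕ) : ℝ) ^ 2 / M - 2| ≤ 4 * t + 2 := by
    rw [mul_div_assoc, ← ht, abs_le]
    constructor <;> linarith
  have h3 : (4 * t + 2) * Real.exp (-t / 4) ≤ 18 := by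
    have : t / 4 + 1 ≤ Real.exp (t / 4) := Real.add_one_le_exp _
    rw [neg_div, Real.exp_neg, ← div_eq_mul_inv, div_le_iff₀ (Real.exp_pos _)]
    linarith
  rw [abs_mul, abs_of_nonneg (centralRatio_nonneg _ _)]
  calc _ ≤ (4 * t + 2) * (Real.exp (-t / 4) * Real.exp (-t / 4)) :=
        mul_le_mul h2 h1 (centralRatio_nonneg _ _) (by positivity)
    _ = (4 * t + 2) * Real.exp (-t / 4) * Real.exp (-t / 4) := by ring
    _ ≤ 18 * Real.exp (-(N : ℝ) ^ 2 / (4 * M)) ^ (k + 1) := by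
      rw [← Real.exp_nat_mul]
      gcongr
      rw [ht]
      push_cast
      have hk : (k + 1 : ℝ) ≤ (k + 1) ^ 2 := by nlinarith [(Nat.cast_nonneg k : (0 : ℝ) ≤ k)]
      have : (k + 1 : ℝ) * (N ^ 2 / (4 * M)) ≤ (k + 1) ^ 2 * (N ^ 2 / (4 * M)) := by gcongr
      calc -(((k + 1 : ℝ) * N) ^ 2 / M) / 4 = -((k + 1) ^ 2 * (N ^ 2 / (4 * M))) := by
            field_simp
        _ ≤ -((k + 1 : ℝ) * (N ^ 2 / (4 * M))) := by linarith
        _ = _ := by ring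

theorem leftTail_le_one (m H : ℕ) : leftTail m H ≤ 1 := by
  rw [leftTail]
  have : (0 : ℝ) ≤ (stripCount H m : ℝ) / catalan m := by positivity
  linarith

theorem leftTail_nonneg (m H : ℕ) : 0 ≤ leftTail m H := by
  rw [leftTail, sub_nonneg, div_le_one (by exact_mod_cast catalan_pos m)]
  rw [← treesOfNumNodesEq_card_eq_catalan]
  exact_mod_cast Finset.card_filter_le _ _

/-- A Gaussian bound that is uniform in `m` and `H`. -/
theorem leftTail_le (m H : ℕ) :
    leftTail m H ≤ 36 * Real.exp (-(H : ℝ) ^ 2 / (4 * (m + 1))) := by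
  rcases Nat.eq_zero_or_pos H with rfl | hH
  · refine (leftTail_le_one _ _).trans ?_
    norm_num
  set r : ℝ := Real.exp (-((H + 1 : ℕ) : ℝ) ^ 2 / (4 * (m + 1 : ℕ))) with hr
  have hr0 : 0 < r := Real.exp_pos _
  have hrle : r ≤ Real.exp (-(H : ℝ) ^ 2 / (4 * (m + 1))) := by
    rw [hr]
    push_cast
    gcongr
    linarith
  refine le_trans ?_ (mul_le_mul_of_nonneg_left hrle (by norm_num))
  -- the series is dominated by a geometric one, and the trivial bound serves if `r` is not small
  rcases le_or_gt r (1 / 2) with h | h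
  · have hgeo : HasSum (fun k : ℕ => 18 * r ^ (k + 1)) (18 * (r * (1 - r)⁻¹)) := by
      refine HasSum.mul_left _ ?_
      simp_rw [pow_succ']
      exact (hasSum_geometric_of_lt_one hr0.le (by linarith)).mul_left _
    have hb := abs_leftTail_term_le (Nat.succ_pos m) (H + 1)
    simp_rw [← Real.norm_eq_abs] at hb
    have := tsum_of_norm_bounded hgeo hb
    rw [← stripCount_div_catalan hH] at this
    refine ((le_abs_self _).trans this).trans ?_
    have : (1 - r)⁻¹ ≤ 2 := by
      rw [inv_le_comm₀ (by linarith) (by norm_num)]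
      linarith
    nlinarith
  · refine (leftTail_le_one _ _).trans ?_
    linarith

/-- The left height, normalized by the square root of the size, converges in law to the Theta
law: the exact tail converges term by term. -/
theorem tendsto_leftTail {H : ℕ → ℕ} {y : ℝ} (hy : 0 < y)
    (hH : Tendsto (fun m : ℕ => (H m : ℝ) / √(m : ℝ)) atTop (𝓝 y)) :
    Tendsto (fun m => leftTail m (H m)) atTop (𝓝 (thetaTail y)) := by
  -- `N` is the number of levels of the strip, indexed by `M = m + 1`
  set N : ℕ → ℕ := fun M => H (M - 1) + 1 with hN
  have hsq : Tendsto (fun M : ℕ => √(M : ℝ)) atTop atTop :=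
    Real.tendsto_sqrt_atTop.comp tendsto_natCast_atTop_atTop
  have hratio : Tendsto (fun m : ℕ => √(m : ℝ) / √((m + 1 : ℕ) : ℝ)) atTop (𝓝 1) := by
    have h := (Real.continuous_sqrt.tendsto 1).comp (tendsto_natCast_div_add_atTop (1 : ℝ))
    rw [Real.sqrt_one] at h
    refine h.congr fun m => ?_
    simp [Real.sqrt_div]
  have hNy : Tendsto (fun M : ℕ => (N M : ℝ) / √(M : ℝ)) atTop (𝓝 y) := by
    rw [← tendsto_add_atTop_iff_nat 1]
    have h1 := (hH.mul hratio).add (((tendsto_add_atTop_iff_nat 1).mpr hsq).inv_tendsto_atTop)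
    rw [mul_one, add_zero] at h1
    refine h1.congr' ?_
    filter_upwards [eventually_gt_atTop 0] with m hm
    have : (0 : ℝ) < √(m : ℝ) := Real.sqrt_pos.mpr (by exact_mod_cast hm)
    simp only [hN, Nat.add_sub_cancel, Pi.inv_apply]
    push_cast
    field_simp
  have hmain : Tendsto (fun M : ℕ => ∑' k : ℕ, (4 * (((k + 1) * N M : ℕ) : ℝ) ^ 2 / M - 2) *
      centralRatio M ((k + 1) * N M)) atTop (𝓝 (thetaTail y)) := by
    set r : ℝ := Real.exp (-(y / 2) ^ 2 / 4) with hr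
    have hr1 : r < 1 := by
      rw [hr, Real.exp_lt_one_iff]
      have : 0 < (y / 2) ^ 2 := by positivity
      linarith
    have hsum : Summable fun k : ℕ => 18 * r ^ (k + 1) := by
      refine Summable.mul_left _ ?_
      exact (summable_nat_add_iff 1).mpr (summable_geometric_of_lt_one (Real.exp_pos _).le hr1)
    refine tendsto_tsum_of_dominated_convergence hsum (fun k => ?_) ?_
    · have hk : Tendsto (fun M : ℕ => (((k + 1) * N M : ℕ) : ℝ) / √(M : ℝ)) atTop
          (𝓝 ((k + 1) * y)) := by
        refine (hNy.const_mul (k + 1 : ℝ)).congr fun M => ?_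
        push_cast
        ring
      have h1 := (((hk.pow 2).const_mul 4).sub_const 2).mul (tendsto_centralRatio hk)
      rw [mul_pow, ← mul_assoc, ← neg_mul] at h1
      refine h1.congr fun M => ?_
      rw [div_pow, Real.sq_sqrt (Nat.cast_nonneg M), mul_div_assoc]
    · filter_upwards [hNy.eventually_const_lt (half_lt_self hy), eventually_gt_atTop 0]
        with M hM h0 k
      refine (abs_leftTail_term_le h0 (N M) k).trans ?_
      have hM' : (0 : ℝ) < M := by exact_mod_cast h0
      rw [hr]
      gcongr 18 * ?_ ^ _
      refine Real.exp_le_exp.mpr ?_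
      have h2 : (y / 2) ^ 2 ≤ ((N M : ℝ) / √(M : ℝ)) ^ 2 := by gcongr
      rw [div_pow (N M : ℝ), Real.sq_sqrt hM'.le] at h2
      rw [show -(N M : ℝ) ^ 2 / (4 * M) = -((N M : ℝ) ^ 2 / M) / 4 by field_simp]
      linarith
  rw [← tendsto_add_atTop_iff_nat 1] at hmain
  refine hmain.congr' ?_
  have hpos : ∀ᶠ m : ℕ in atTop, 0 < H m := by
    filter_upwards [hH.eventually_const_lt hy] with m hm
    by_contra! h0
    simp [Nat.le_zero.mp h0] at hm
  filter_upwards [hpos] with m hm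
  rw [leftTail, stripCount_div_catalan hm]
  simp [hN]

/-- The tail of the Theta law is nonnegative, being a limit of proportions. -/
theorem thetaTail_nonneg {y : ℝ} (hy : 0 < y) : 0 ≤ thetaTail y := by
  have hlim : Tendsto (fun m : ℕ => (⌊y * √(m : ℝ)⌋₊ : ℝ) / √(m : ℝ)) atTop (𝓝 y) :=
    (tendsto_nat_floor_mul_div_atTop hy.le).comp
      (Real.tendsto_sqrt_atTop.comp tendsto_natCast_atTop_atTop)
  exact ge_of_tendsto' (tendsto_leftTail hy hlim) fun m => leftTail_nonneg _ _

/-! ### The mean of the Theta law -/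

/-- The Gaussian sum `∑ exp (-j² x²)` over the positive integers `j`. -/
noncomputable def gaussSum (x : ℝ) : ℝ := ∑' j : ℕ, Real.exp (-((j : ℝ) + 1) ^ 2 * x ^ 2)

theorem exp_sq_le_geometric (j : ℕ) (x : ℝ) :
    Real.exp (-((j : ℝ) + 1) ^ 2 * x ^ 2) ≤ Real.exp (-x ^ 2) ^ (j + 1) := by
  rw [← Real.exp_nat_mul]
  refine Real.exp_le_exp.mpr ?_
  have hj : (0 : ℝ) ≤ j := Nat.cast_nonneg j
  have : ((j : ℝ) + 1) * x ^ 2 ≤ ((j : ℝ) + 1) ^ 2 * x ^ 2 := by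
    gcongr
    nlinarith
  push_cast
  linarith

theorem summable_geometric_exp_neg_sq {x : ℝ} (hx : x ≠ 0) :
    Summable fun j : ℕ => Real.exp (-x ^ 2) ^ (j + 1) := by
  refine (summable_nat_add_iff 1).mpr (summable_geometric_of_lt_one (Real.exp_pos _).le ?_)
  rw [Real.exp_lt_one_iff]
  have : 0 < x ^ 2 := by positivity
  linarith

theorem summable_gaussSum {x : ℝ} (hx : x ≠ 0) :
    Summable fun j : ℕ => Real.exp (-((j : ℝ) + 1) ^ 2 * x ^ 2) :=
  (summable_geometric_exp_neg_sq hx).of_nonneg_of_le (fun _ => (Real.exp_pos _).le)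
    fun j => exp_sq_le_geometric j x

theorem gaussSum_nonneg (x : ℝ) : 0 ≤ gaussSum x := tsum_nonneg fun _ => (Real.exp_pos _).le

theorem gaussSum_le {x : ℝ} (hx : 1 ≤ x) : gaussSum x ≤ 2 * Real.exp (-x) := by
  have hx0 : x ≠ 0 := by linarith
  have h1 : Real.exp (-x ^ 2) ≤ Real.exp (-x) := Real.exp_le_exp.mpr (by nlinarith)
  have h2 : Real.exp (-x ^ 2) ≤ 1 / 2 := by
    have h3 : Real.exp (-x ^ 2) ≤ Real.exp (-1) := Real.exp_le_exp.mpr (by nlinarith)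
    have h4 : (1 : ℝ) + 1 ≤ Real.exp 1 := Real.add_one_le_exp 1
    refine h3.trans ?_
    rw [Real.exp_neg, inv_le_comm₀ (Real.exp_pos _) (by norm_num)]
    linarith
  have hgeo : HasSum (fun j : ℕ => Real.exp (-x ^ 2) ^ (j + 1))
      (Real.exp (-x ^ 2) * (1 - Real.exp (-x ^ 2))⁻¹) := by
    simp_rw [pow_succ' (Real.exp _)]
    exact (hasSum_geometric_of_lt_one (Real.exp_pos _).le (h2.trans_lt (by norm_num))).mul_left _
  have h5 := hasSum_le (fun j => exp_sq_le_geometric j x) (summable_gaussSum hx0).hasSum hgeo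
  refine h5.trans ?_
  have h6 : (1 - Real.exp (-x ^ 2))⁻¹ ≤ 2 := by
    rw [inv_le_comm₀ (by linarith) (by norm_num)]
    linarith
  have h7 := Real.exp_pos (-x ^ 2)
  nlinarith

theorem tendsto_gaussSum_atTop : Tendsto gaussSum atTop (𝓝 0) := by
  have h : Tendsto (fun x : ℝ => 2 * Real.exp (-x)) atTop (𝓝 0) := by
    simpa using Real.tendsto_exp_neg_atTop_nhds_zero.const_mul 2
  refine tendsto_of_tendsto_of_tendsto_of_le_of_le' tendsto_const_nhds h
    (Eventually.of_forall gaussSum_nonneg) ?_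
  filter_upwards [eventually_ge_atTop 1] with x hx using gaussSum_le hx

theorem tendsto_mul_gaussSum_atTop : Tendsto (fun x => x * gaussSum x) atTop (𝓝 0) := by
  have h : Tendsto (fun x : ℝ => 2 * (x * Real.exp (-x))) atTop (𝓝 0) := by
    simpa using (Real.tendsto_pow_mul_exp_neg_atTop_nhds_zero 1).const_mul 2
  refine tendsto_of_tendsto_of_tendsto_of_le_of_le' tendsto_const_nhds h ?_ ?_
  · filter_upwards [eventually_ge_atTop 0] with x hx using mul_nonneg hx (gaussSum_nonneg x)
  · filter_upwards [eventually_ge_atTop 1] with x hx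
    nlinarith [gaussSum_le hx]

/-- The functional equation of the Jacobi theta function. -/
theorem two_mul_mul_gaussSum {x : ℝ} (hx : 0 < x) :
    2 * x * gaussSum x = √Real.pi * (1 + 2 * gaussSum (Real.pi / x)) - x := by
  have key {u : ℝ} (hu : u ≠ 0) :
      ∑' n : ℤ, Real.exp (-u ^ 2 * (n : ℝ) ^ 2) = 1 + 2 * gaussSum u := by
    have h1 : (fun n : ℕ => Real.exp (-u ^ 2 * (((n : ℤ) + 1 : ℤ) : ℝ) ^ 2)) =
        fun j : ℕ => Real.exp (-((j : ℝ) + 1) ^ 2 * u ^ 2) := by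
      funext n
      congr 1
      push_cast
      ring
    have h2 : (fun n : ℕ => Real.exp (-u ^ 2 * ((-((n : ℤ) + 1) : ℤ) : ℝ) ^ 2)) =
        fun j : ℕ => Real.exp (-((j : ℝ) + 1) ^ 2 * u ^ 2) := by
      funext n
      congr 1
      push_cast
      ring
    have hs := summable_gaussSum hu
    rw [tsum_of_add_one_of_neg_add_one (f := fun n : ℤ => Real.exp (-u ^ 2 * (n : ℝ) ^ 2))
      (h1 ▸ hs) (h2 ▸ hs), h1, h2]
    simp only [gaussSum]
    norm_num
    ring
  have hpi := Real.pi_pos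
  have h := Real.tsum_exp_neg_mul_int_sq (a := x ^ 2 / Real.pi) (by positivity)
  have e1 : -Real.pi * (x ^ 2 / Real.pi) = -x ^ 2 := by field_simp
  have e2 : -Real.pi / (x ^ 2 / Real.pi) = -(Real.pi / x) ^ 2 := by field_simp
  have e3 : (x ^ 2 / Real.pi) ^ (1 / 2 : ℝ) = x / √Real.pi := by
    rw [← Real.sqrt_eq_rpow, Real.sqrt_div' _ hpi.le, Real.sqrt_sq hx.le]
  rw [e1, e2, e3, key hx.ne', key (by positivity)] at h
  have hs : 0 < √Real.pi := Real.sqrt_pos.mpr hpi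
  rw [one_div_div, div_mul_eq_mul_div, eq_div_iff hx.ne'] at h
  linarith

theorem hasDerivAt_neg_two_mul_gaussSum {x : ℝ} (hx : 0 < x) :
    HasDerivAt (fun x => -(2 * x * gaussSum x)) (thetaTail x) x := by
  set t : Set ℝ := Set.Ioi (x / 2)
  set u : ℕ → ℝ := fun j => 18 * Real.exp (-(x / 4) ^ 2) ^ (j + 1)
  have hu : Summable u := (summable_geometric_exp_neg_sq (by positivity)).mul_left _
  have hterm (j : ℕ) (y : ℝ) : HasDerivAt
      (fun y : ℝ => -(2 * y * Real.exp (-((j : ℝ) + 1) ^ 2 * y ^ 2)))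
      ((4 * ((j : ℝ) + 1) ^ 2 * y ^ 2 - 2) * Real.exp (-((j : ℝ) + 1) ^ 2 * y ^ 2)) y := by
    have h1 : HasDerivAt (fun y : ℝ => -((j : ℝ) + 1) ^ 2 * y ^ 2)
        (-((j : ℝ) + 1) ^ 2 * (2 * y)) y := by
      simpa using (hasDerivAt_pow 2 y).const_mul (-((j : ℝ) + 1) ^ 2)
    have h2 := (((hasDerivAt_id y).const_mul 2).mul h1.exp).neg
    exact h2.congr_deriv (by simp only [id]; ring)
  have hbound (j : ℕ) (y : ℝ) (hy : y ∈ t) :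
      ‖(4 * ((j : ℝ) + 1) ^ 2 * y ^ 2 - 2) * Real.exp (-((j : ℝ) + 1) ^ 2 * y ^ 2)‖ ≤ u j := by
    have hy' : x / 2 < y := hy
    set s : ℝ := ((j : ℝ) + 1) ^ 2 * y ^ 2 with hs
    have hs0 : 0 ≤ s := by positivity
    have h2 : |4 * s - 2| ≤ 4 * s + 2 := by
      rw [abs_le]
      constructor <;> linarith
    have h3 : (4 * s + 2) * Real.exp (-s / 4) ≤ 18 := by
      have : s / 4 + 1 ≤ Real.exp (s / 4) := Real.add_one_le_exp _
      rw [neg_div, Real.exp_neg, ← div_eq_mul_inv, div_le_iff₀ (Real.exp_pos _)]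
      linarith
    have h4 : Real.exp (-s * (3 / 4)) ≤ Real.exp (-(x / 4) ^ 2) ^ (j + 1) := by
      refine le_trans (Real.exp_le_exp.mpr ?_) (exp_sq_le_geometric j (x / 4))
      have : (x / 4) ^ 2 ≤ y ^ 2 * (3 / 4) := by nlinarith
      have := mul_le_mul_of_nonneg_left this (sq_nonneg ((j : ℝ) + 1))
      rw [hs]
      linarith
    rw [Real.norm_eq_abs, abs_mul, abs_of_pos (Real.exp_pos _), mul_assoc 4, ← hs, neg_mul, ← hs]
    calc |4 * s - 2| * Real.exp (-s) ≤ (4 * s + 2) * Real.exp (-s) := by gcongr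
      _ = (4 * s + 2) * Real.exp (-s / 4) * Real.exp (-s * (3 / 4)) := by
        rw [mul_assoc, ← Real.exp_add]
        congr 2
        ring
      _ ≤ 18 * Real.exp (-(x / 4) ^ 2) ^ (j + 1) := by gcongr
  have hmem : x ∈ t := half_lt_self hx
  have h := hasDerivAt_tsum_of_isPreconnected hu isOpen_Ioi isPreconnected_Ioi
    (fun j y _ => hterm j y) hbound hmem (((summable_gaussSum hx.ne').mul_left (2 * x)).neg) hmem
  refine h.congr_of_eventuallyEq (Eventually.of_forall fun y => ?_)
  simp only [tsum_neg, tsum_mul_left, gaussSum]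

theorem tendsto_neg_two_mul_gaussSum_zero :
    Tendsto (fun x => -(2 * x * gaussSum x)) (𝓝[>] 0) (𝓝 (-√Real.pi)) := by
  have hinv : Tendsto (fun x : ℝ => Real.pi / x) (𝓝[>] 0) atTop :=
    tendsto_inv_nhdsGT_zero.const_mul_atTop Real.pi_pos
  have hid : Tendsto (fun x : ℝ => x) (𝓝[>] 0) (𝓝 0) := nhdsWithin_le_nhds
  have h := ((((tendsto_gaussSum_atTop.comp hinv).const_mul 2).const_add 1).const_mul
    √Real.pi).sub hid |>.neg
  rw [mul_zero, add_zero, mul_one, sub_zero] at h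
  refine h.congr' ?_
  filter_upwards [self_mem_nhdsWithin] with x hx
  rw [two_mul_mul_gaussSum hx]
  rfl

/-- The standard Theta law has mean `√π`. Its tail function has the antiderivative
`-2 * x * gaussSum x`, whose limit at `0` is given by the theta functional equation. -/
theorem integral_thetaTail : ∫ x in Set.Ioi (0 : ℝ), thetaTail x = √Real.pi := by
  -- the antiderivative, continuously extended to `0`
  set F : ℝ → ℝ := Function.update (fun x => -(2 * x * gaussSum x)) 0 (-√Real.pi) with hF
  have hFx {x : ℝ} (hx : 0 < x) : F =ᶠ[𝓝 x] fun x => -(2 * x * gaussSum x) := by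
    filter_upwards [lt_mem_nhds hx] with y hy using Function.update_of_ne hy.ne' _ _
  have hF0 : F 0 = -√Real.pi := Function.update_self ..
  have hcont : ContinuousWithinAt F (Set.Ici 0) 0 := by
    rw [hF, continuousWithinAt_update_same]
    rw [Set.Ici_sdiff_left]
    exact tendsto_neg_two_mul_gaussSum_zero
  have hlim : Tendsto F atTop (𝓝 0) := by
    have h := (tendsto_mul_gaussSum_atTop.const_mul 2).neg
    rw [mul_zero, neg_zero] at h
    refine h.congr' ?_
    filter_upwards [eventually_gt_atTop 0] with x hx
    rw [(hFx hx).eq_of_nhds]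
    ring
  rw [integral_Ioi_of_hasDerivAt_of_nonneg hcont
    (fun x hx => (hasDerivAt_neg_two_mul_gaussSum hx).congr_of_eventuallyEq (hFx hx))
    (fun x hx => thetaTail_nonneg hx) hlim, hF0]
  ring

/-! ### Left and right steps on the paths to the leaves -/

/-- The leaves of a binary tree, each recorded by the numbers of left steps and of right steps on
the path from the root to it. -/
def leafSteps : BinTree → List (ℕ × ℕ)
  | .nil => [(0, 0)]
  | .node _ l r =>
    (leafSteps l).map (fun p => (p.1 + 1, p.2)) ++ (leafSteps r).map fun p => (p.1, p.2 + 1)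

theorem mem_leafSteps_node {u : Unit} {l r : BinTree} {p : ℕ × ℕ} :
    p ∈ leafSteps (.node u l r) ↔ (∃ q ∈ leafSteps l, (q.1 + 1, q.2) = p) ∨
      ∃ q ∈ leafSteps r, (q.1, q.2 + 1) = p := by
  rw [leafSteps, List.mem_append, List.mem_map, List.mem_map]

theorem add_le_height_of_mem_leafSteps {τ : BinTree} {p : ℕ × ℕ} (hp : p ∈ leafSteps τ) :
    p.1 + p.2 ≤ τ.height := by
  induction τ generalizing p with
  | nil => simp_all [leafSteps]
  | node u l r hl hr =>
    rw [height]
    rcases mem_leafSteps_node.mp hp with ⟨q, hq, rfl⟩ | ⟨q, hq, rfl⟩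
    · have := hl hq
      have := le_max_left l.height r.height
      simp only
      omega
    · have := hr hq
      have := le_max_right l.height r.height
      simp only
      omega

theorem exists_leafSteps_add_eq_height (τ : BinTree) :
    ∃ p ∈ leafSteps τ, p.1 + p.2 = τ.height := by
  induction τ with
  | nil => exact ⟨(0, 0), by simp [leafSteps], rfl⟩
  | node u l r hl hr =>
    rw [height]
    rcases le_total r.height l.height with h | h
    · obtain ⟨p, hp, he⟩ := hl
      refine ⟨(p.1 + 1, p.2), mem_leafSteps_node.mpr (Or.inl ⟨p, hp, rfl⟩), ?_⟩
      rw [max_eq_left h, ← he]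
      ring
    · obtain ⟨p, hp, he⟩ := hr
      refine ⟨(p.1, p.2 + 1), mem_leafSteps_node.mpr (Or.inr ⟨p, hp, rfl⟩), ?_⟩
      rw [max_eq_right h, ← he]
      ring

theorem fst_le_leftHeight_of_mem_leafSteps {τ : BinTree} {p : ℕ × ℕ} (hp : p ∈ leafSteps τ) :
    p.1 ≤ leftHeight τ := by
  induction τ generalizing p with
  | nil => simp_all [leafSteps]
  | node u l r hl hr =>
    rw [leftHeight]
    rcases mem_leafSteps_node.mp hp with ⟨q, hq, rfl⟩ | ⟨q, hq, rfl⟩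
    · exact le_max_of_le_left (Nat.succ_le_succ (hl hq))
    · exact le_max_of_le_right (hr hq : q.1 ≤ _)

theorem exists_leafSteps_fst_eq_leftHeight (τ : BinTree) :
    ∃ p ∈ leafSteps τ, p.1 = leftHeight τ := by
  induction τ with
  | nil => exact ⟨(0, 0), by simp [leafSteps], rfl⟩
  | node u l r hl hr =>
    rw [leftHeight]
    rcases le_total (leftHeight r) (leftHeight l + 1) with h | h
    · obtain ⟨p, hp, he⟩ := hl
      exact ⟨(p.1 + 1, p.2), mem_leafSteps_node.mpr (Or.inl ⟨p, hp, rfl⟩),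
        by rw [max_eq_left h, ← he]⟩
    · obtain ⟨p, hp, he⟩ := hr
      exact ⟨(p.1, p.2 + 1), mem_leafSteps_node.mpr (Or.inr ⟨p, hp, rfl⟩),
        by rw [max_eq_right h, ← he]⟩

/-- The sum over the leaves of a tree of `a` to the number of left steps times `b` to the number of
right steps. -/
noncomputable def leafWeight (a b : ℝ) (τ : BinTree) : ℝ :=
  ((leafSteps τ).map fun p => a ^ p.1 * b ^ p.2).sum

theorem leafWeight_nil (a b : ℝ) : leafWeight a b .nil = 1 := by
  simp [leafWeight, leafSteps]

theorem leafWeight_node (a b : ℝ) (u : Unit) (l r : BinTree) :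
    leafWeight a b (.node u l r) = a * leafWeight a b l + b * leafWeight a b r := by
  simp only [leafWeight, leafSteps, List.map_append, List.map_map, List.sum_append]
  rw [← List.sum_map_mul_left, ← List.sum_map_mul_left]
  congr 2
  · refine List.map_congr_left fun p _ => ?_
    simp only [Function.comp_apply]
    ring
  · refine List.map_congr_left fun p _ => ?_
    simp only [Function.comp_apply]
    ring

theorem le_leafWeight {a b : ℝ} (ha : 0 ≤ a) (hb : 0 ≤ b) {τ : BinTree} {p : ℕ × ℕ}
    (hp : p ∈ leafSteps τ) : a ^ p.1 * b ^ p.2 ≤ leafWeight a b τ := by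
  refine List.single_le_sum (fun x hx => ?_) _ (List.mem_map.mpr ⟨p, hp, rfl⟩)
  obtain ⟨q, -, rfl⟩ := List.mem_map.mp hx
  positivity

theorem leafWeight_nonneg {a b : ℝ} (ha : 0 ≤ a) (hb : 0 ≤ b) (τ : BinTree) :
    0 ≤ leafWeight a b τ := by
  refine List.sum_nonneg fun x hx => ?_
  obtain ⟨q, -, rfl⟩ := List.mem_map.mp hx
  positivity

theorem leafWeight_one_one (τ : BinTree) : leafWeight 1 1 τ = τ.numNodes + 1 := by
  induction τ with
  | nil => simp [leafWeight_nil]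
  | node u l r hl hr =>
    rw [leafWeight_node, hl, hr, numNodes]
    push_cast
    ring

theorem sum_leafWeight_succ (a b : ℝ) (m : ℕ) :
    ∑ τ ∈ treesOfNumNodesEq (m + 1), leafWeight a b τ =
      (a + b) * ∑ ij ∈ Finset.HasAntidiagonal.antidiagonal m,
        (∑ τ ∈ treesOfNumNodesEq ij.1, leafWeight a b τ) * (treesOfNumNodesEq ij.2).card := by
  rw [sum_treesOfNumNodesEq_succ]
  have h : ∀ ij : ℕ × ℕ, ∑ l ∈ treesOfNumNodesEq ij.1, ∑ r ∈ treesOfNumNodesEq ij.2,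
      leafWeight a b (.node () l r) =
        a * ((∑ τ ∈ treesOfNumNodesEq ij.1, leafWeight a b τ) * (treesOfNumNodesEq ij.2).card) +
        b * ((∑ τ ∈ treesOfNumNodesEq ij.2, leafWeight a b τ) *
          (treesOfNumNodesEq ij.1).card) := by
    intro ij
    simp only [leafWeight_node, Finset.sum_add_distrib, Finset.sum_const, nsmul_eq_mul,
      ← Finset.mul_sum]
    ring
  rw [Finset.sum_congr rfl fun ij _ => h ij, Finset.sum_add_distrib, ← Finset.mul_sum,
    ← Finset.mul_sum, add_mul]
  congr 2
  rw [← Finset.Nat.sum_antidiagonal_swap]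
  rfl

/-- The total leaf weight depends on `a + b` only: among the trees of a given size, the number of
leaves that are reached by a given path depends on the length of the path only. -/
theorem sum_leafWeight_congr {a b a' b' : ℝ} (h : a + b = a' + b') (m : ℕ) :
    ∑ τ ∈ treesOfNumNodesEq m, leafWeight a b τ =
      ∑ τ ∈ treesOfNumNodesEq m, leafWeight a' b' τ := by
  induction m using Nat.strong_induction_on with
  | _ m ih =>
    cases m with
    | zero => simp [leafWeight_nil]
    | succ m =>
      rw [sum_leafWeight_succ, sum_leafWeight_succ, h]
      congr 1
      refine Finset.sum_congr rfl fun ij hij => ?_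
      rw [ih ij.1 (Nat.lt_succ_of_le (Finset.HasAntidiagonal.antidiagonal.fst_le hij))]

theorem sum_leafWeight_of_add_eq_two {a b : ℝ} (h : a + b = 2) (m : ℕ) :
    ∑ τ ∈ treesOfNumNodesEq m, leafWeight a b τ = (m + 1) * catalan m := by
  rw [sum_leafWeight_congr (h.trans one_add_one_eq_two.symm), ← treesOfNumNodesEq_card_eq_catalan,
    mul_comm, ← nsmul_eq_mul, ← Finset.sum_const]
  refine Finset.sum_congr rfl fun τ hτ => ?_
  rw [leafWeight_one_one, mem_treesOfNumNodesEq.mp hτ]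

/-- The fraction of the binary trees with `m` internal nodes that have the property `p`. -/
noncomputable def treeProb (m : ℕ) (p : BinTree → Prop) : ℝ :=
  open Classical in ((treesOfNumNodesEq m).filter p).card / (catalan m : ℝ)

theorem treeProb_eq (m : ℕ) (p : BinTree → Prop) [DecidablePred p] :
    treeProb m p = ((treesOfNumNodesEq m).filter p).card / (catalan m : ℝ) := by
  rw [treeProb]
  congr!

theorem treeProb_nonneg (m : ℕ) (p : BinTree → Prop) : 0 ≤ treeProb m p := by
  rw [treeProb]; positivity

theorem treeProb_mono {m : ℕ} {p q : BinTree → Prop} (h : ∀ τ, τ.numNodes = m → p τ → q τ) :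
    treeProb m p ≤ treeProb m q := by
  classical
  rw [treeProb_eq, treeProb_eq]
  refine div_le_div_of_nonneg_right (Nat.cast_le.mpr (Finset.card_le_card fun τ hτ => ?_))
    (Nat.cast_nonneg _)
  rw [Finset.mem_filter] at hτ ⊢
  exact ⟨hτ.1, h τ (mem_treesOfNumNodesEq.mp hτ.1) hτ.2⟩

theorem treeProb_eq_zero {m : ℕ} {p : BinTree → Prop} (h : ∀ τ, τ.numNodes = m → ¬ p τ) :
    treeProb m p = 0 := by
  classical
  rw [treeProb_eq, Finset.filter_false_of_mem fun τ hτ => h τ (mem_treesOfNumNodesEq.mp hτ)]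
  simp

theorem treeProb_or_le (m : ℕ) (p q : BinTree → Prop) :
    treeProb m (fun τ => p τ ∨ q τ) ≤ treeProb m p + treeProb m q := by
  classical
  rw [treeProb_eq, treeProb_eq, treeProb_eq, ← add_div]
  gcongr
  rw [Finset.filter_or]
  exact_mod_cast Finset.card_union_le _ _

theorem treeProb_not (m : ℕ) (p : BinTree → Prop) :
    treeProb m (fun τ => ¬ p τ) = 1 - treeProb m p := by
  classical
  have h := Finset.card_filter_add_card_filter_not (s := treesOfNumNodesEq m) p
  rw [treesOfNumNodesEq_card_eq_catalan] at h
  have hc : (catalan m : ℝ) ≠ 0 := by exact_mod_cast (catalan_pos m).ne'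
  rw [treeProb_eq, treeProb_eq, eq_sub_iff_add_eq, ← add_div, div_eq_one_iff_eq hc, add_comm]
  exact_mod_cast h

theorem leftTail_eq_treeProb (m H : ℕ) : leftTail m H = treeProb m fun τ => H ≤ leftHeight τ := by
  rw [leftTail]
  have h := treeProb_not m fun τ => leftHeight τ < H
  simp only [not_lt] at h
  rw [h]
  rw [treeProb_eq, stripCount]

/-- Large deviations of the difference of left and right steps at some leaf. The weights
`a = exp c / cosh c` and `b = exp (-c) / cosh c` have sum two, hence the mean total leaf weight
is the number of leaves, and Markov's inequality applies. -/
theorem treeProb_exists_leafSteps_le (m : ℕ) (c s : ℝ) :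
    treeProb m (fun τ => ∃ p ∈ leafSteps τ,
      s + c ^ 2 / 2 * ((p.1 : ℝ) + p.2) < c * ((p.1 : ℝ) - p.2)) ≤ (m + 1) * Real.exp (-s) := by
  classical
  have hcosh := Real.cosh_pos c
  set a : ℝ := Real.exp c / Real.cosh c with ha
  set b : ℝ := Real.exp (-c) / Real.cosh c with hb
  have ha0 : 0 < a := by positivity
  have hb0 : 0 < b := by positivity
  have hab : a + b = 2 := by
    rw [ha, hb, ← add_div, Real.cosh_eq]
    have := Real.exp_pos c
    have := Real.exp_pos (-c)
    field_simp
  have ha1 : Real.exp (c - c ^ 2 / 2) ≤ a := by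
    rw [Real.exp_sub, ha]
    gcongr
    exact Real.cosh_le_exp_half_sq c
  have hb1 : Real.exp (-c - c ^ 2 / 2) ≤ b := by
    rw [Real.exp_sub, hb]
    gcongr
    exact Real.cosh_le_exp_half_sq c
  rw [treeProb_eq, div_le_iff₀ (by exact_mod_cast catalan_pos m)]
  set S := (treesOfNumNodesEq m).filter fun τ => ∃ p ∈ leafSteps τ,
      s + c ^ 2 / 2 * ((p.1 : ℝ) + p.2) < c * ((p.1 : ℝ) - p.2) with hS
  have h1 : (S.card : ℝ) * Real.exp s ≤ (m + 1) * catalan m := by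
    rw [← sum_leafWeight_of_add_eq_two hab, ← nsmul_eq_mul, ← Finset.sum_const]
    refine (Finset.sum_le_sum fun τ hτ => ?_).trans (Finset.sum_le_sum_of_subset_of_nonneg
      (Finset.filter_subset _ _) fun τ _ _ => leafWeight_nonneg ha0.le hb0.le τ)
    obtain ⟨p, hp, hlt⟩ := (Finset.mem_filter.mp hτ).2
    refine le_trans ?_ (le_leafWeight ha0.le hb0.le hp)
    calc Real.exp s ≤ Real.exp (p.1 * (c - c ^ 2 / 2) + p.2 * (-c - c ^ 2 / 2)) :=
          Real.exp_le_exp.mpr (by linarith)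
      _ = Real.exp (c - c ^ 2 / 2) ^ p.1 * Real.exp (-c - c ^ 2 / 2) ^ p.2 := by
        rw [Real.exp_add, Real.exp_nat_mul, Real.exp_nat_mul]
      _ ≤ _ := by gcongr
  calc (S.card : ℝ) = S.card * Real.exp s * Real.exp (-s) := by
        rw [mul_assoc, ← Real.exp_add]; simp
    _ ≤ (m + 1) * catalan m * Real.exp (-s) := by gcongr
    _ = _ := by ring

/-! ### Comparing the height with twice the left height -/

/-- At every leaf the numbers of left and right steps are nearly equal: their difference is at most
`s / c` plus the fraction `c / 2` of the depth of the leaf. -/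
def IsBalanced (c s : ℝ) (τ : BinTree) : Prop :=
  ∀ p ∈ leafSteps τ, c * |(p.1 : ℝ) - p.2| ≤ s + c ^ 2 / 2 * ((p.1 : ℝ) + p.2)

theorem treeProb_not_isBalanced_le (m : ℕ) (c s : ℝ) :
    treeProb m (fun τ => ¬ IsBalanced c s τ) ≤ 2 * ((m + 1) * Real.exp (-s)) := by
  rw [two_mul]
  refine le_trans ?_ (add_le_add (treeProb_exists_leafSteps_le m c s)
    (treeProb_exists_leafSteps_le m (-c) s))
  refine le_trans (treeProb_mono fun τ _ hτ => ?_) (treeProb_or_le m _ _)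
  simp only [IsBalanced, not_forall, not_le] at hτ
  obtain ⟨p, hp, hlt⟩ := hτ
  rcases le_total 0 ((p.1 : ℝ) - p.2) with h | h
  · rw [abs_of_nonneg h] at hlt
    exact Or.inl ⟨p, hp, hlt⟩
  · rw [abs_of_nonpos h] at hlt
    exact Or.inr ⟨p, hp, by rw [neg_sq]; linarith⟩

theorem IsBalanced.height_le {c s : ℝ} (hc : 0 < c) {τ : BinTree} (h : IsBalanced c s τ) :
    (1 - c / 2) * τ.height ≤ 2 * leftHeight τ + s / c := by
  obtain ⟨p, hp, he⟩ := exists_leafSteps_add_eq_height τ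
  have h1 := h p hp
  have h2 : (p.1 : ℝ) ≤ leftHeight τ := by exact_mod_cast fst_le_leftHeight_of_mem_leafSteps hp
  have h3 : (p.1 : ℝ) + p.2 = τ.height := by exact_mod_cast he
  have h4 := neg_abs_le ((p.1 : ℝ) - p.2)
  have h5 : |(p.1 : ℝ) - p.2| ≤ s / c + c / 2 * τ.height := by
    rw [← h3, ← mul_le_mul_iff_of_pos_left hc]
    refine h1.trans_eq ?_
    field_simp
  linarith

theorem IsBalanced.leftHeight_le {c s : ℝ} (hc : 0 < c) {τ : BinTree} (h : IsBalanced c s τ) :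
    2 * leftHeight τ ≤ (1 + c / 2) * τ.height + s / c := by
  obtain ⟨p, hp, he⟩ := exists_leafSteps_fst_eq_leftHeight τ
  have h1 := h p hp
  have h2 : (p.1 : ℝ) = leftHeight τ := by exact_mod_cast he
  have h3 : (p.1 : ℝ) + p.2 ≤ τ.height := by exact_mod_cast add_le_height_of_mem_leafSteps hp
  have h4 := le_abs_self ((p.1 : ℝ) - p.2)
  have h5 : |(p.1 : ℝ) - p.2| ≤ s / c + c / 2 * ((p.1 : ℝ) + p.2) := by
    rw [← mul_le_mul_iff_of_pos_left hc]
    refine h1.trans_eq ?_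
    field_simp
  have h6 : c / 2 * ((p.1 : ℝ) + p.2) ≤ c / 2 * τ.height := by gcongr
  linarith

/-- The fraction of the binary trees with `m` internal nodes whose height exceeds `x`. -/
noncomputable def heightTail (m : ℕ) (x : ℝ) : ℝ := treeProb m fun τ => x < τ.height

/-- Outside of the unbalanced trees, a large height forces a large left height. -/
theorem heightTail_le_leftTail_add (m : ℕ) {c : ℝ} (hc : 0 < c) (hc2 : c < 2) (s x : ℝ) :
    heightTail m x ≤ leftTail m ⌈((1 - c / 2) * x - s / c) / 2⌉₊ +
      2 * ((m + 1) * Real.exp (-s)) := by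
  rw [leftTail_eq_treeProb]
  refine le_trans ?_ (add_le_add_right (treeProb_not_isBalanced_le m c s) _)
  refine le_trans (treeProb_mono fun τ _ hτ => ?_) (treeProb_or_le m _ _)
  by_cases hb : IsBalanced c s τ
  · left
    rw [Nat.ceil_le]
    have h1 := hb.height_le hc
    have h2 : (1 - c / 2) * x ≤ (1 - c / 2) * τ.height :=
      mul_le_mul_of_nonneg_left (le_of_lt hτ) (by linarith)
    linarith
  · exact Or.inr hb

/-- Outside of the unbalanced trees, a large left height forces a large height. -/
theorem leftTail_le_heightTail_add (m : ℕ) {c : ℝ} (hc : 0 < c) (s x : ℝ) :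
    leftTail m (⌊((1 + c / 2) * x + s / c) / 2⌋₊ + 1) ≤ heightTail m x +
      2 * ((m + 1) * Real.exp (-s)) := by
  rw [leftTail_eq_treeProb]
  refine le_trans ?_ (add_le_add_right (treeProb_not_isBalanced_le m c s) _)
  refine le_trans (treeProb_mono fun τ _ hτ => ?_) (treeProb_or_le m _ _)
  by_cases hb : IsBalanced c s τ
  · left
    have h1 := hb.leftHeight_le hc
    have h2 := Nat.lt_of_floor_lt (Nat.lt_of_succ_le hτ)
    have h3 : (1 + c / 2) * x < (1 + c / 2) * τ.height := by linarith
    exact lt_of_mul_lt_mul_left h3 (by linarith)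
  · exact Or.inr hb

/-- Rounding up does not affect limits relative to a diverging normalization. -/
theorem tendsto_ceil_div {f g : ℕ → ℝ} {y : ℝ} (hy : 0 < y) (hg : Tendsto g atTop atTop)
    (h : Tendsto (fun m => f m / g m) atTop (𝓝 y)) :
    Tendsto (fun m => (⌈f m⌉₊ : ℝ) / g m) atTop (𝓝 y) := by
  have h2 := h.add hg.inv_tendsto_atTop
  rw [add_zero] at h2
  refine tendsto_of_tendsto_of_tendsto_of_le_of_le' h h2 ?_ ?_
  · filter_upwards [hg.eventually_gt_atTop 0] with m hm
    exact div_le_div_of_nonneg_right (Nat.le_ceil _) hm.le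
  · filter_upwards [hg.eventually_gt_atTop 0, h.eventually_const_lt hy] with m hm hf
    rw [Pi.inv_apply, ← one_div, ← add_div]
    refine div_le_div_of_nonneg_right (Nat.ceil_lt_add_one ?_).le hm.le
    by_contra! hneg
    exact absurd hf (not_lt.mpr (div_nonpos_of_nonpos_of_nonneg hneg.le hm.le))

/-- The height of a large uniform binary tree is asymptotically twice the left height, hence it has
the same limit law up to a factor of two. -/
theorem tendsto_heightTail {x : ℕ → ℝ} {y : ℝ} (hy : 0 < y)
    (hx : Tendsto (fun m : ℕ => x m / √(m : ℝ)) atTop (𝓝 y)) :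
    Tendsto (fun m => heightTail m (x m)) atTop (𝓝 (thetaTail (y / 2))) := by
  -- with `c = (m + 1) ^ (-1 / 4)` and `s = 2 * log (m + 1)`, the exceptional trees are negligible
  -- and `s / c` is small compared with the square root of `m`
  set c : ℕ → ℝ := fun m => ((m : ℝ) + 1) ^ (-(1 / 4) : ℝ) with hc
  set s : ℕ → ℝ := fun m => 2 * Real.log ((m : ℝ) + 1) with hs
  have hM : Tendsto (fun m : ℕ => (m : ℝ) + 1) atTop atTop :=
    tendsto_atTop_add_const_right _ _ tendsto_natCast_atTop_atTop
  have hsq : Tendsto (fun m : ℕ => √(m : ℝ)) atTop atTop :=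
    Real.tendsto_sqrt_atTop.comp tendsto_natCast_atTop_atTop
  have hcpos (m : ℕ) : 0 < c m := by simp only [hc]; positivity
  have hc0 : Tendsto c atTop (𝓝 0) := (tendsto_rpow_neg_atTop (by norm_num)).comp hM
  have herr : Tendsto (fun m : ℕ => 2 * (((m : ℝ) + 1) * Real.exp (-s m))) atTop (𝓝 0) := by
    have h := hM.inv_tendsto_atTop.const_mul 2
    rw [mul_zero] at h
    refine h.congr fun m => ?_
    have hm : (0 : ℝ) < m + 1 := by positivity
    simp only [hs, Pi.inv_apply]
    rw [Real.exp_neg, two_mul (Real.log _), Real.exp_add, Real.exp_log hm]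
    field_simp
  have hsc : Tendsto (fun m : ℕ => s m / c m / √(m : ℝ)) atTop (𝓝 0) := by
    have h1 : Tendsto (fun t : ℝ => Real.log t / t ^ (1 / 4 : ℝ)) atTop (𝓝 0) :=
      (isLittleO_log_rpow_atTop (by norm_num)).tendsto_div_nhds_zero
    have h2 : Tendsto (fun m : ℕ => √((m : ℝ) + 1) / √(m : ℝ)) atTop (𝓝 1) := by
      have h := (Real.continuous_sqrt.tendsto 1⁻¹).comp
        ((tendsto_natCast_div_add_atTop (1 : ℝ)).inv₀ one_ne_zero)
      rw [inv_one, Real.sqrt_one] at h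
      refine h.congr fun m => ?_
      simp [Real.sqrt_div']
    have h3 := ((h1.comp hM).const_mul 2).mul h2
    rw [mul_zero, zero_mul] at h3
    refine h3.congr fun m => ?_
    have hm : (0 : ℝ) < m + 1 := by positivity
    simp only [hs, hc, Function.comp_apply]
    have h4 : √((m : ℝ) + 1) = (m + 1 : ℝ) ^ (1 / 4 : ℝ) * (m + 1 : ℝ) ^ (1 / 4 : ℝ) := by
      rw [← Real.rpow_add hm, Real.sqrt_eq_rpow]
      norm_num
    rw [h4, Real.rpow_neg hm.le]
    have : (0 : ℝ) < (m + 1 : ℝ) ^ (1 / 4 : ℝ) := by positivity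
    field_simp
  have hy2 : 0 < y / 2 := by positivity
  have hup : Tendsto (fun m => leftTail m ⌈((1 - c m / 2) * x m - s m / c m) / 2⌉₊ +
      2 * (((m : ℝ) + 1) * Real.exp (-s m))) atTop (𝓝 (thetaTail (y / 2) + 0)) := by
    refine (tendsto_leftTail hy2 (tendsto_ceil_div hy2 hsq ?_)).add herr
    have h := ((((hc0.div_const 2).const_sub 1).mul hx).sub hsc).div_const 2
    rw [zero_div, sub_zero, sub_zero, one_mul] at h
    refine h.congr fun m => ?_
    ring
  have hlow : Tendsto (fun m => leftTail m (⌊((1 + c m / 2) * x m + s m / c m) / 2⌋₊ + 1) -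
      2 * (((m : ℝ) + 1) * Real.exp (-s m))) atTop (𝓝 (thetaTail (y / 2) - 0)) := by
    have h := ((((hc0.div_const 2).const_add 1).mul hx).add hsc).div_const 2
    rw [zero_div, add_zero, add_zero, one_mul] at h
    have hf : Tendsto (fun m => (((1 + c m / 2) * x m + s m / c m) / 2) / √(m : ℝ)) atTop
        (𝓝 (y / 2)) := h.congr fun m => by ring
    refine (tendsto_leftTail hy2 ?_).sub herr
    have hf2 := hf.add hsq.inv_tendsto_atTop
    rw [add_zero] at hf2
    refine tendsto_of_tendsto_of_tendsto_of_le_of_le' hf hf2 ?_ ?_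
    · filter_upwards with m
      push_cast
      exact div_le_div_of_nonneg_right (Nat.lt_floor_add_one _).le (Real.sqrt_nonneg _)
    · filter_upwards [hsq.eventually_gt_atTop 0, hf.eventually_const_lt hy2] with m hm hpos
      rw [Pi.inv_apply, ← one_div, ← add_div]
      push_cast
      refine div_le_div_of_nonneg_right (add_le_add_left (Nat.floor_le ?_) _) hm.le
      by_contra! hneg
      exact absurd hpos (not_lt.mpr (div_nonpos_of_nonpos_of_nonneg hneg.le hm.le))
  rw [add_zero] at hup
  rw [sub_zero] at hlow
  refine tendsto_of_tendsto_of_tendsto_of_le_of_le' hlow hup ?_ ?_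
  · filter_upwards with m
    rw [sub_le_iff_le_add]
    exact leftTail_le_heightTail_add m (hcpos m) (s m) (x m)
  · filter_upwards [hc0.eventually_lt_const two_pos] with m hm
    exact heightTail_le_leftTail_add m (hcpos m) hm (s m) (x m)

/-! ### The mean height -/

/-- The mirror image of a binary tree. -/
def mirror : BinTree → BinTree
  | .nil => .nil
  | .node u l r => .node u (mirror r) (mirror l)

theorem mirror_mirror (τ : BinTree) : mirror (mirror τ) = τ := by
  induction τ with
  | nil => rfl
  | node u l r hl hr => rw [mirror, mirror, hl, hr]

theorem numNodes_mirror (τ : BinTree) : (mirror τ).numNodes = τ.numNodes := by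
  induction τ with
  | nil => rfl
  | node u l r hl hr => rw [mirror, numNodes, numNodes, hl, hr]; ring

theorem treeProb_mirror (m : ℕ) (p : BinTree → Prop) :
    treeProb m (fun τ => p (mirror τ)) = treeProb m p := by
  classical
  rw [treeProb_eq, treeProb_eq]
  congr 2
  refine Finset.card_nbij' mirror mirror (fun τ hτ => ?_) (fun τ hτ => ?_)
    (fun τ _ => mirror_mirror τ) (fun τ _ => mirror_mirror τ) <;>
  simp_all [mem_treesOfNumNodesEq, numNodes_mirror, mirror_mirror]

/-- A path to a deepest leaf consists of left steps and of right steps. -/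
theorem height_le_leftHeight_add (τ : BinTree) :
    τ.height ≤ leftHeight τ + leftHeight (mirror τ) := by
  induction τ with
  | nil => simp
  | node u l r hl hr =>
    simp only [height, leftHeight, mirror]
    omega

theorem heightTail_le (m : ℕ) {x : ℝ} (hx : 0 ≤ x) :
    heightTail m x ≤ 72 * Real.exp (-x ^ 2 / (16 * (m + 1))) := by
  have h1 : heightTail m x ≤ leftTail m ⌈x / 2⌉₊ + leftTail m ⌈x / 2⌉₊ := by
    rw [leftTail_eq_treeProb]
    nth_rewrite 2 [← treeProb_mirror]
    refine le_trans (treeProb_mono fun τ _ hτ => ?_) (treeProb_or_le m _ _)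
    have h2 : (τ.height : ℝ) ≤ leftHeight τ + leftHeight (mirror τ) := by
      exact_mod_cast height_le_leftHeight_add τ
    rw [Nat.ceil_le, Nat.ceil_le]
    by_contra! h3
    linarith [h3.1, h3.2]
  have h2 := leftTail_le m ⌈x / 2⌉₊
  have h3 : Real.exp (-(⌈x / 2⌉₊ : ℝ) ^ 2 / (4 * (m + 1))) ≤
      Real.exp (-x ^ 2 / (16 * (m + 1))) := by
    refine Real.exp_le_exp.mpr ?_
    have h4 : (x / 2) ^ 2 ≤ (⌈x / 2⌉₊ : ℝ) ^ 2 := by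
      gcongr
      exact Nat.le_ceil _
    calc -(⌈x / 2⌉₊ : ℝ) ^ 2 / (4 * (m + 1)) ≤ -(x / 2) ^ 2 / (4 * (m + 1)) := by gcongr
      _ = _ := by field_simp; ring
  linarith

theorem heightTail_nonneg (m : ℕ) (x : ℝ) : 0 ≤ heightTail m x := treeProb_nonneg _ _

theorem antitone_heightTail (m : ℕ) : Antitone (heightTail m) := fun _ _ h =>
  treeProb_mono fun _ _ hτ => lt_of_le_of_lt h hτ

/-- The mean height of the binary trees with `m` internal nodes. -/
noncomputable def meanHeight (m : ℕ) : ℝ :=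
  (∑ τ ∈ treesOfNumNodesEq m, (τ.height : ℝ)) / catalan m

theorem integral_indicator_Iio {c : ℝ} (hc : 0 ≤ c) :
    ∫ y in Set.Ioi (0 : ℝ), (Set.Iio c).indicator (fun _ => (1 : ℝ)) y = c := by
  rw [setIntegral_indicator measurableSet_Iio, setIntegral_const, Set.Ioi_inter_Iio]
  simp [hc]

/-- The mean height is the integral of the tail of the height. -/
theorem integral_heightTail {m : ℕ} (hm : 0 < m) :
    ∫ y in Set.Ioi (0 : ℝ), heightTail m (y * √(m : ℝ)) = meanHeight m / √(m : ℝ) := by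
  have hs : 0 < √(m : ℝ) := Real.sqrt_pos.mpr (by exact_mod_cast hm)
  have h1 (y : ℝ) : heightTail m (y * √(m : ℝ)) = (∑ τ ∈ treesOfNumNodesEq m,
      (Set.Iio ((τ.height : ℝ) / √(m : ℝ))).indicator (fun _ => (1 : ℝ)) y) / catalan m := by
    classical
    rw [heightTail, treeProb_eq, Finset.card_filter]
    push_cast
    congr 1
    refine Finset.sum_congr rfl fun τ _ => ?_
    simp only [Set.indicator_apply, Set.mem_Iio, lt_div_iff₀ hs]
  have hint (c : ℝ) : IntegrableOn ((Set.Iio c).indicator fun _ => (1 : ℝ)) (Set.Ioi 0) := by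
    rw [IntegrableOn, integrable_indicator_iff measurableSet_Iio, IntegrableOn,
      Measure.restrict_restrict measurableSet_Iio, Set.Iio_inter_Ioi]
    exact integrable_const _
  simp_rw [h1]
  rw [integral_div, integral_finsetSum _ fun τ _ => hint _, meanHeight, div_right_comm]
  congr 1
  rw [Finset.sum_div]
  refine Finset.sum_congr rfl fun τ _ => ?_
  rw [integral_indicator_Iio (by positivity)]

theorem tendsto_meanHeight :
    Tendsto (fun m : ℕ => meanHeight m / √(m : ℝ)) atTop (𝓝 (2 * √Real.pi)) := by
  have hlim : ∫ y in Set.Ioi (0 : ℝ), thetaTail (y / 2) = 2 * √Real.pi := by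
    have h := integral_comp_mul_right_Ioi thetaTail 0 (b := (2 : ℝ)⁻¹) (by norm_num)
    simp only [← div_eq_mul_inv, zero_div, inv_inv, smul_eq_mul] at h
    rw [h, integral_thetaTail]
  rw [← hlim]
  have h : Tendsto (fun m : ℕ => ∫ y in Set.Ioi (0 : ℝ), heightTail m (y * √(m : ℝ))) atTop
      (𝓝 (∫ y in Set.Ioi (0 : ℝ), thetaTail (y / 2))) := by
    refine tendsto_integral_filter_of_dominated_convergence
      (fun y => 72 * Real.exp (-(1 / 32) * y ^ 2)) ?_ ?_ ?_ ?_
    · filter_upwards with m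
      refine (Antitone.measurable fun y z hyz => antitone_heightTail m ?_).aestronglyMeasurable
      gcongr
    · filter_upwards [eventually_gt_atTop 0] with m hm
      filter_upwards [ae_restrict_mem measurableSet_Ioi] with y hy
      have hy0 : (0 : ℝ) < y := hy
      have hm1 : (1 : ℝ) ≤ m := by exact_mod_cast hm
      rw [Real.norm_of_nonneg (heightTail_nonneg _ _)]
      refine (heightTail_le m (by positivity)).trans ?_
      gcongr
      rw [mul_pow, Real.sq_sqrt (by positivity), div_le_iff₀ (by positivity)]
      nlinarith [sq_nonneg y]
    · exact ((integrable_exp_neg_mul_sq (by norm_num)).const_mul 72).integrableOn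
    · filter_upwards [ae_restrict_mem measurableSet_Ioi] with y hy
      refine tendsto_heightTail hy (tendsto_const_nhds.congr' ?_)
      filter_upwards [eventually_gt_atTop 0] with m hm
      have hs : 0 < √(m : ℝ) := Real.sqrt_pos.mpr (by exact_mod_cast hm)
      rw [mul_div_cancel_right₀ _ hs.ne']
  refine h.congr' ?_
  filter_upwards [eventually_gt_atTop 0] with m hm using integral_heightTail hm

/-! ### The parallel process with threshold one -/

/-- The bits seen from the child `b` of the root. -/
def subBits (ω : Bits) (b : Bool) : Bits := fun v => ω (b :: v)

/-- A node is born if the bits of all its proper ancestors are `1`. The path is read from the root,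
so that the recursion passes to the subtree at a child of the root. -/
def Born : Bits → Node → Prop
  | _, [] => True
  | ω, b :: v => ω [] = true ∧ Born (subBits ω b) v

/-- Extending a path at its end instead of its beginning. -/
theorem born_append_singleton {ω : Bits} {v : Node} {b : Bool} :
    Born ω (v ++ [b]) ↔ Born ω v ∧ ω v = true := by
  induction v generalizing ω with
  | nil => simp [Born]
  | cons c v ih =>
    rw [List.cons_append, Born, Born, ih, and_assoc]
    rfl

theorem iterate_one_singleton (ω : Bits) (v : Node) :
    Thread.iterate 1 ω ⟨[v], []⟩ =
      if ω v = true then [⟨[v ++ [false]], []⟩, ⟨[v ++ [true]], []⟩] else [⟨[], []⟩] := by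
  simp [Thread.iterate, Thread.pop, push]

/-- With threshold `1`, a thread that is not yet idle owns exactly one node, and after `k` units of
time these are the born nodes of level `k`. -/
theorem mem_threads_one (ω : Bits) (k : ℕ) :
    (∀ th ∈ threads 1 ω k, th = ⟨[], []⟩ ∨ ∃ v, th = ⟨[v], []⟩) ∧
      ∀ v, ⟨[v], []⟩ ∈ threads 1 ω k ↔ v.length = k ∧ Born ω v := by
  induction k with
  | zero =>
    refine ⟨fun th hth => Or.inr ⟨[], by simpa [threads] using hth⟩, fun v => ?_⟩
    cases v <;> simp [threads, Born]
  | succ k ih =>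
    refine ⟨fun th hth => ?_, fun v => ?_⟩
    · rw [threads, List.mem_flatMap] at hth
      obtain ⟨th', h1, h2⟩ := hth
      rcases ih.1 th' h1 with rfl | ⟨w, rfl⟩
      · simp [Thread.iterate, Thread.pop] at h2
      · rw [iterate_one_singleton] at h2
        split_ifs at h2 <;> simp only [List.mem_cons, List.not_mem_nil, or_false] at h2
        · rcases h2 with rfl | rfl <;> exact Or.inr ⟨_, rfl⟩
        · exact Or.inl h2
    · rw [threads, List.mem_flatMap]
      constructor
      · rintro ⟨th', h1, h2⟩
        rcases ih.1 th' h1 with rfl | ⟨w, rfl⟩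
        · simp [Thread.iterate, Thread.pop] at h2
        · rw [iterate_one_singleton] at h2
          obtain ⟨hl, hb⟩ := (ih.2 w).mp h1
          split_ifs at h2 with hw <;>
            simp only [List.mem_cons, List.not_mem_nil, or_false, Thread.mk.injEq, and_true,
              List.cons.injEq, reduceCtorEq] at h2
          rcases h2 with rfl | rfl <;>
            exact ⟨by simp [hl], born_append_singleton.mpr ⟨hb, hw⟩⟩
      · rintro ⟨hl, hb⟩
        obtain ⟨w, b, rfl⟩ : ∃ w b, v = w ++ [b] := by
          rcases List.eq_nil_or_concat v with rfl | ⟨w, b, rfl⟩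
          · simp at hl
          · exact ⟨w, b, List.concat_eq_append⟩
        rw [born_append_singleton] at hb
        refine ⟨⟨[w], []⟩, (ih.2 w).mpr ⟨by simpa using hl, hb.1⟩, ?_⟩
        rw [iterate_one_singleton, if_pos hb.2]
        cases b <;> simp

theorem mem_treatedAt_one {ω : Bits} {k : ℕ} {v : Node} :
    v ∈ treatedAt 1 ω k ↔ v.length = k ∧ Born ω v := by
  rw [← (mem_threads_one ω k).2, treatedAt, List.mem_filterMap]
  constructor
  · rintro ⟨th, h1, h2⟩
    rcases (mem_threads_one ω k).1 th h1 with rfl | ⟨w, rfl⟩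
    · simp [Thread.pop] at h2
    · simp only [Thread.pop, Option.map_some, Option.some.injEq] at h2
      rwa [← h2]
  · exact fun h => ⟨_, h, rfl⟩

theorem mem_generated_one {ω : Bits} {v : Node} : v ∈ generated 1 ω ↔ Born ω v := by
  simp [generated, mem_treatedAt_one]

theorem nil_mem_nodeSet (τ : BinTree) : [] ∈ nodeSet τ := by
  cases τ <;> simp [nodeSet]

theorem cons_mem_nodeSet {u : Unit} {l r : BinTree} {b : Bool} {v : Node} :
    b :: v ∈ nodeSet (.node u l r) ↔ v ∈ nodeSet (if b then r else l) := by
  cases b <;> simp [nodeSet]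

theorem cons_notMem_nodeSet_nil {b : Bool} {v : Node} : b :: v ∉ nodeSet .nil := by
  simp [nodeSet]

theorem generated_eq_nodeSet_nil {ω : Bits} : generated 1 ω = nodeSet .nil ↔ ω [] = false := by
  constructor
  · intro h
    by_contra hω
    have h1 : [true] ∈ generated 1 ω := mem_generated_one.mpr ⟨by simpa using hω, trivial⟩
    rw [h] at h1
    exact cons_notMem_nodeSet_nil h1
  · intro h
    ext v
    cases v with
    | nil => simp [mem_generated_one, Born, nodeSet]
    | cons b v => simp [mem_generated_one, Born, nodeSet, h]

theorem generated_eq_nodeSet_node {ω : Bits} {u : Unit} {l r : BinTree} :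
    generated 1 ω = nodeSet (.node u l r) ↔ ω [] = true ∧
      generated 1 (subBits ω false) = nodeSet l ∧ generated 1 (subBits ω true) = nodeSet r := by
  constructor
  · intro h
    have h1 : [true] ∈ generated 1 ω := by
      rw [h, cons_mem_nodeSet]
      exact nil_mem_nodeSet _
    have h2 : ω [] = true := (mem_generated_one.mp h1).1
    refine ⟨h2, ?_, ?_⟩ <;> ext v
    · have h3 := Set.ext_iff.mp h (false :: v)
      rw [cons_mem_nodeSet, mem_generated_one, Born] at h3
      simpa [h2, mem_generated_one] using h3
    · have h3 := Set.ext_iff.mp h (true :: v)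
      rw [cons_mem_nodeSet, mem_generated_one, Born] at h3
      simpa [h2, mem_generated_one] using h3
  · rintro ⟨h1, h2, h3⟩
    ext v
    rw [mem_generated_one]
    rcases v with _ | ⟨b, v⟩
    · simp [Born, nil_mem_nodeSet]
    · rw [cons_mem_nodeSet, Born]
      cases b
      · simp [h1, ← h2, mem_generated_one]
      · simp [h1, ← h3, mem_generated_one]

/-- A finite set of generated nodes is the node set of a tree, by induction on a bound for the
levels of the nodes. -/
theorem exists_generated_eq_nodeSet {ω : Bits} (h : (generated 1 ω).Finite) :
    ∃ τ, generated 1 ω = nodeSet τ := by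
  obtain ⟨K, hK⟩ := (h.image List.length).bddAbove
  replace hK : ∀ v, Born ω v → v.length ≤ K := fun v hv =>
    hK ⟨v, mem_generated_one.mpr hv, rfl⟩
  clear h
  induction K generalizing ω with
  | zero =>
    refine ⟨.nil, generated_eq_nodeSet_nil.mpr ?_⟩
    by_contra hω
    have := hK [true] ⟨by simpa using hω, trivial⟩
    simp at this
  | succ K ih =>
    by_cases hω : ω [] = true
    · have hsub (b : Bool) : ∃ τ, generated 1 (subBits ω b) = nodeSet τ :=
        ih fun v hv => Nat.le_of_succ_le_succ (hK (b :: v) ⟨hω, hv⟩)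
      obtain ⟨l, hl⟩ := hsub false
      obtain ⟨r, hr⟩ := hsub true
      exact ⟨.node () l r, generated_eq_nodeSet_node.mpr ⟨hω, hl, hr⟩⟩
    · exact ⟨.nil, generated_eq_nodeSet_nil.mpr (by simpa using hω)⟩

theorem size_eq (τ : BinTree) : size τ = 2 * τ.numNodes + 1 := by
  rw [size, numLeaves_eq_numNodes_succ]
  ring

theorem encard_nodeSet (τ : BinTree) : (nodeSet τ).encard = size τ := by
  induction τ with
  | nil => simp [nodeSet, size]
  | node u l r hl hr =>
    rw [nodeSet, Set.encard_union_eq, Set.encard_union_eq, List.cons_injective.encard_image,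
      List.cons_injective.encard_image, hl, hr, Set.encard_singleton]
    · simp only [size_eq, numNodes]
      norm_cast
      ring
    · simp
    · rw [Set.disjoint_left]
      simp

theorem finite_nodeSet (τ : BinTree) : (nodeSet τ).Finite := by
  rw [← Set.encard_ne_top_iff, encard_nodeSet]
  exact ENat.natCast_ne_top _

theorem nodeSet_injective : Function.Injective nodeSet := by
  intro τ
  induction τ with
  | nil =>
    rintro (_ | ⟨u, l, r⟩) h
    · rfl
    · have h1 : [true] ∈ nodeSet (.node u l r) := cons_mem_nodeSet.mpr (nil_mem_nodeSet _)
      rw [← h] at h1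
      exact absurd h1 cons_notMem_nodeSet_nil
  | node u l r hl hr =>
    rintro (_ | ⟨u', l', r'⟩) h
    · have h1 : [true] ∈ nodeSet (.node u l r) := cons_mem_nodeSet.mpr (nil_mem_nodeSet _)
      rw [h] at h1
      exact absurd h1 cons_notMem_nodeSet_nil
    · have h1 (b : Bool) : nodeSet (if b then r else l) = nodeSet (if b then r' else l') := by
        ext v
        rw [← cons_mem_nodeSet (u := u), h, cons_mem_nodeSet]
      have hl' : l = l' := hl (h1 false)
      have hr' : r = r' := hr (h1 true)
      rw [hl', hr']

theorem length_le_height_of_mem_nodeSet {τ : BinTree} {v : Node} (hv : v ∈ nodeSet τ) :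
    v.length ≤ τ.height := by
  induction τ generalizing v with
  | nil => simp_all [nodeSet]
  | node u l r hl hr =>
    rcases v with _ | ⟨b, v⟩
    · simp
    · rw [cons_mem_nodeSet] at hv
      rw [List.length_cons, height]
      cases b
      · exact Nat.succ_le_succ ((hl hv).trans (le_max_left _ _))
      · exact Nat.succ_le_succ ((hr hv).trans (le_max_right _ _))

theorem exists_mem_nodeSet_length_eq_height (τ : BinTree) :
    ∃ v ∈ nodeSet τ, v.length = τ.height := by
  induction τ with
  | nil => exact ⟨[], nil_mem_nodeSet _, rfl⟩
  | node u l r hl hr =>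
    rw [height]
    rcases le_total r.height l.height with h | h
    · obtain ⟨v, hv, he⟩ := hl
      exact ⟨false :: v, cons_mem_nodeSet.mpr hv, by rw [max_eq_left h, List.length_cons, he]⟩
    · obtain ⟨v, hv, he⟩ := hr
      exact ⟨true :: v, cons_mem_nodeSet.mpr hv, by rw [max_eq_right h, List.length_cons, he]⟩

theorem runningTime_eq_height {ω : Bits} {τ : BinTree} (h : generated 1 ω = nodeSet τ) :
    runningTime 1 ω = τ.height := by
  have hk (k : ℕ) : treatedAt 1 ω k ≠ [] ↔ ∃ v ∈ nodeSet τ, v.length = k := by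
    rw [← List.length_pos_iff, List.length_pos_iff_exists_mem]
    simp only [mem_treatedAt_one, ← h, mem_generated_one, and_comm]
  refine IsGreatest.csSup_eq ⟨(hk _).mpr (exists_mem_nodeSet_length_eq_height τ), fun k h1 => ?_⟩
  obtain ⟨v, hv, rfl⟩ := (hk k).mp h1
  exact length_le_height_of_mem_nodeSet hv

/-! ### The law of the generated tree -/

/-- The event that the run generates the tree `τ`. -/
def treeEvent (τ : BinTree) : Set Bits := {ω | generated 1 ω = nodeSet τ}

/-- The bits that produce a given tree: `true` at its internal nodes, `false` at its leaves, and the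
irrelevant value `false` outside of the tree. -/
def innerBits : BinTree → Bits
  | .nil, _ => false
  | .node _ _ _, [] => true
  | .node _ l _, false :: v => innerBits l v
  | .node _ _ r, true :: v => innerBits r v

/-- Generating a given tree is a cylinder event: it prescribes the bits of the nodes of the tree. -/
theorem generated_eq_nodeSet_iff {ω : Bits} {τ : BinTree} :
    generated 1 ω = nodeSet τ ↔ ∀ v ∈ nodeSet τ, ω v = innerBits τ v := by
  induction τ generalizing ω with
  | nil => rw [generated_eq_nodeSet_nil]; simp [nodeSet, innerBits]
  | node u l r hl hr =>
    rw [generated_eq_nodeSet_node, hl, hr]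
    constructor
    · rintro ⟨h1, h2, h3⟩ v hv
      rcases v with _ | ⟨b, v⟩
      · exact h1
      · rw [cons_mem_nodeSet] at hv
        cases b
        · exact h2 v hv
        · exact h3 v hv
    · intro h
      exact ⟨h [] (nil_mem_nodeSet _), fun v hv => h (false :: v) (cons_mem_nodeSet.mpr hv),
        fun v hv => h (true :: v) (cons_mem_nodeSet.mpr hv)⟩

theorem treeEvent_eq_pi (τ : BinTree) :
    treeEvent τ = Set.pi (finite_nodeSet τ).toFinset fun v => {innerBits τ v} := by
  ext ω
  simp [treeEvent, generated_eq_nodeSet_iff, Set.mem_pi]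

theorem measurableSet_treeEvent (τ : BinTree) : MeasurableSet (treeEvent τ) := by
  rw [treeEvent_eq_pi]
  exact MeasurableSet.pi (Finset.countable_toSet _) fun _ _ => measurableSet_singleton _

instance : IsProbabilityMeasure coinMeasure := by
  unfold coinMeasure
  infer_instance

theorem coinMeasure_treeEvent (τ : BinTree) :
    coinMeasure (treeEvent τ) = (2 : ENNReal)⁻¹ ^ size τ := by
  have hcard : (finite_nodeSet τ).toFinset.card = size τ := by
    have h := encard_nodeSet τ
    rw [(finite_nodeSet τ).encard_eq_coe_toFinset_card] at h
    exact_mod_cast h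
  rw [treeEvent_eq_pi, coinMeasure, Measure.infinitePi_pi _ fun _ _ => measurableSet_singleton _]
  simp only [PMF.toMeasure_apply_singleton _ _ (measurableSet_singleton _),
    PMF.uniformOfFintype_apply, Fintype.card_bool, Finset.prod_const, hcard, Nat.cast_ofNat]

theorem pairwiseDisjoint_treeEvent (s : Set BinTree) : s.PairwiseDisjoint treeEvent := by
  intro τ _ σ _ hne
  rw [Function.onFun, Set.disjoint_left]
  intro ω h1 h2
  exact hne (nodeSet_injective (h1.symm.trans h2))

theorem coinMeasure_biUnion_treeEvent {m : ℕ} {F : Finset BinTree}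
    (hF : F ⊆ treesOfNumNodesEq m) :
    coinMeasure (⋃ τ ∈ F, treeEvent τ) = F.card * (2 : ENNReal)⁻¹ ^ (2 * m + 1) := by
  rw [measure_biUnion_finset (pairwiseDisjoint_treeEvent _) fun τ _ => measurableSet_treeEvent τ,
    ← nsmul_eq_mul, ← Finset.sum_const]
  refine Finset.sum_congr rfl fun τ hτ => ?_
  rw [coinMeasure_treeEvent, size_eq, mem_treesOfNumNodesEq.mp (hF hτ)]

theorem setOf_encard_generated_eq (m : ℕ) :
    {ω | (generated 1 ω).encard = (2 * m + 1 : ℕ)} = ⋃ τ ∈ treesOfNumNodesEq m, treeEvent τ := by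
  ext ω
  simp only [Set.mem_ofPred_eq, Set.mem_iUnion, exists_prop, treeEvent, mem_treesOfNumNodesEq]
  constructor
  · intro h
    obtain ⟨τ, hτ⟩ := exists_generated_eq_nodeSet (Set.finite_of_encard_eq_coe h)
    rw [hτ, encard_nodeSet, size_eq, Nat.cast_inj] at h
    exact ⟨τ, by omega, hτ⟩
  · rintro ⟨τ, rfl, h⟩
    rw [h, encard_nodeSet, size_eq]

/-- Given its size, the generated tree is uniformly distributed: an event that is decided by the
generated tree has the corresponding probability under the uniform distribution. -/
theorem condMeasure_real_eq_treeProb {m : ℕ} {A : Set Bits} {p : BinTree → Prop}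
    (h : ∀ τ, τ.numNodes = m → ∀ ω ∈ treeEvent τ, ω ∈ A ↔ p τ) :
    (condMeasure 1 (2 * m + 1)).real A = treeProb m p := by
  classical
  -- the event and the conditioning meet in a union of disjoint tree events of equal mass
  have hA : {ω | (generated 1 ω).encard = (2 * m + 1 : ℕ)} ∩ A =
      ⋃ τ ∈ (treesOfNumNodesEq m).filter p, treeEvent τ := by
    rw [setOf_encard_generated_eq]
    ext ω
    simp only [Set.mem_inter_iff, Set.mem_iUnion, exists_prop, Finset.mem_filter,
      mem_treesOfNumNodesEq]
    constructor
    · rintro ⟨⟨τ, hτ, hω⟩, hA⟩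
      exact ⟨τ, ⟨hτ, (h τ hτ ω hω).mp hA⟩, hω⟩
    · rintro ⟨τ, ⟨hτ, hp⟩, hω⟩
      exact ⟨⟨τ, hτ, hω⟩, (h τ hτ ω hω).mpr hp⟩
  have hmeas : MeasurableSet {ω | (generated 1 ω).encard = (2 * m + 1 : ℕ)} := by
    rw [setOf_encard_generated_eq]
    exact Finset.measurableSet_biUnion _ fun τ _ => measurableSet_treeEvent τ
  rw [measureReal_def, condMeasure, cond_apply hmeas, hA, setOf_encard_generated_eq,
    coinMeasure_biUnion_treeEvent subset_rfl,
    coinMeasure_biUnion_treeEvent (Finset.filter_subset _ _), treesOfNumNodesEq_card_eq_catalan,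
    treeProb_eq]
  simp only [ENNReal.toReal_mul, ENNReal.toReal_inv, ENNReal.toReal_pow, ENNReal.toReal_natCast,
    ENNReal.toReal_ofNat]
  have hc : (catalan m : ℝ) ≠ 0 := by exact_mod_cast (catalan_pos m).ne'
  field_simp

theorem integral_runningTime (m : ℕ) :
    ∫ ω, (runningTime 1 ω : ℝ) ∂(condMeasure 1 (2 * m + 1)) = meanHeight m := by
  have hconst (τ : BinTree) : Set.EqOn (fun ω => (runningTime 1 ω : ℝ)) (fun _ => (τ.height : ℝ))
      (treeEvent τ) := fun ω hω => by
    simp only [runningTime_eq_height hω]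
  rw [condMeasure, ProbabilityTheory.cond, integral_smul_measure, setOf_encard_generated_eq,
    integral_biUnion_finset _ (fun τ _ => measurableSet_treeEvent τ)
      (pairwiseDisjoint_treeEvent _) fun τ _ => (integrableOn_congr_fun (hconst τ)
        (measurableSet_treeEvent τ)).mpr (integrableOn_const (measure_ne_top _ _)),
    coinMeasure_biUnion_treeEvent subset_rfl, treesOfNumNodesEq_card_eq_catalan, meanHeight,
    Finset.sum_congr rfl fun τ hτ => show _ = (2 : ℝ)⁻¹ ^ (2 * m + 1) * (τ.height : ℝ) from ?_]
  · rw [← Finset.mul_sum]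
    simp only [smul_eq_mul, ENNReal.toReal_mul, ENNReal.toReal_inv, ENNReal.toReal_pow,
      ENNReal.toReal_natCast, ENNReal.toReal_ofNat]
    have hc : (catalan m : ℝ) ≠ 0 := by exact_mod_cast (catalan_pos m).ne'
    field_simp
  · rw [setIntegral_congr_fun (measurableSet_treeEvent τ) (hconst τ), setIntegral_const,
      measureReal_def, coinMeasure_treeEvent, size_eq, mem_treesOfNumNodesEq.mp hτ]
    simp

theorem treeProb_singleton (τ : BinTree) :
    treeProb τ.numNodes (fun σ => σ = τ) = 1 / ({σ | size σ = size τ}.ncard : ℝ) := by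
  classical
  have h : {σ : BinTree | size σ = size τ} = (treesOfNumNodesEq τ.numNodes : Set BinTree) := by
    ext σ
    simp only [Set.mem_ofPred_eq, Finset.mem_coe, mem_treesOfNumNodesEq, size_eq]
    omega
  rw [h, Set.ncard_coe_finset, treesOfNumNodesEq_card_eq_catalan, treeProb_eq,
    Finset.filter_eq', if_pos (mem_treesOfNumNodesEq_numNodes τ), Finset.card_singleton,
    Nat.cast_one]

theorem tendsto_sqrt_size_div_sqrt :
    Tendsto (fun m : ℕ => √((2 * m + 1 : ℕ) : ℝ) / √(m : ℝ)) atTop (𝓝 √2) := by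
  have h : Tendsto (fun m : ℕ => (2 : ℝ) + (m : ℝ)⁻¹) atTop (𝓝 (2 + 0)) :=
    tendsto_natCast_atTop_atTop.inv_tendsto_atTop.const_add 2
  rw [add_zero] at h
  refine ((Real.continuous_sqrt.tendsto 2).comp h).congr' ?_
  filter_upwards [eventually_gt_atTop 0] with m hm
  have hm' : (0 : ℝ) < m := by exact_mod_cast hm
  rw [← Real.sqrt_div' _ hm'.le, Function.comp_apply]
  congr 1
  push_cast
  field_simp

theorem tendsto_condMeasure_runningTime (x : ℝ) :
    Tendsto (fun m : ℕ => (condMeasure 1 (2 * m + 1)).real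
      {ω | (runningTime 1 ω : ℝ) / (2 * √(Real.pi * ((2 * m + 1 : ℕ) : ℝ))) ≤ x})
      atTop (𝓝 (thetaCDF (√(2 * Real.pi) * x))) := by
  have hprob (m : ℕ) : (condMeasure 1 (2 * m + 1)).real
      {ω | (runningTime 1 ω : ℝ) / (2 * √(Real.pi * ((2 * m + 1 : ℕ) : ℝ))) ≤ x} =
      1 - heightTail m (x * (2 * √(Real.pi * ((2 * m + 1 : ℕ) : ℝ)))) := by
    rw [heightTail, ← treeProb_not]
    refine condMeasure_real_eq_treeProb fun τ _ ω hω => ?_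
    have hpos : 0 < 2 * √(Real.pi * ((2 * m + 1 : ℕ) : ℝ)) := by
      have := Real.pi_pos
      positivity
    rw [Set.mem_ofPred_eq, runningTime_eq_height hω, div_le_iff₀ hpos, not_lt]
  simp_rw [hprob]
  have hpi : 0 < √(2 * Real.pi) := Real.sqrt_pos.mpr (by positivity)
  rcases lt_or_ge 0 x with hx | hx
  · rw [thetaCDF, if_pos (mul_pos hpi hx)]
    have hy : √(2 * Real.pi) * x = 2 * √Real.pi * x * √2 / 2 := by
      rw [Real.sqrt_mul (by norm_num)]
      ring
    rw [hy]
    have hpi' : 0 < √Real.pi := Real.sqrt_pos.mpr Real.pi_pos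
    refine (tendsto_heightTail (by positivity) ?_).const_sub 1
    refine (tendsto_sqrt_size_div_sqrt.const_mul (2 * √Real.pi * x)).congr fun m => ?_
    rw [Real.sqrt_mul Real.pi_pos.le]
    ring
  · rw [thetaCDF, if_neg (not_lt.mpr (mul_nonpos_of_nonneg_of_nonpos hpi.le hx))]
    refine tendsto_const_nhds.congr' ?_
    filter_upwards [eventually_gt_atTop 0] with m hm
    -- a tree with an internal node has positive height
    rw [heightTail, ← treeProb_not]
    refine (treeProb_eq_zero fun τ hτ => not_not.mpr ?_).symm
    have h1 : 0 < τ.height := by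
      rcases τ with _ | ⟨u, l, r⟩
      · rw [numNodes] at hτ
        omega
      · exact Nat.succ_pos _
    have h2 : (0 : ℝ) < τ.height := by exact_mod_cast h1
    exact lt_of_le_of_lt (mul_nonpos_of_nonpos_of_nonneg hx (by positivity)) h2

theorem isEquivalent_integral_runningTime :
    (fun m : ℕ => ∫ ω, (runningTime 1 ω : ℝ) ∂(condMeasure 1 (2 * m + 1)))
      ~[atTop] (fun m : ℕ => √(2 * Real.pi * ((2 * m + 1 : ℕ) : ℝ))) := by
  simp_rw [integral_runningTime]
  have hpi := Real.pi_pos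
  have h1 := tendsto_sqrt_size_div_sqrt.const_mul √(2 * Real.pi)
  have h2 : √(2 * Real.pi) * √2 = 2 * √Real.pi := by
    rw [mul_comm 2, Real.sqrt_mul hpi.le, mul_assoc, Real.mul_self_sqrt (by norm_num), mul_comm]
  rw [h2] at h1
  have h3 := tendsto_meanHeight.div h1 (by positivity)
  rw [div_self (by positivity)] at h3
  refine isEquivalent_of_tendsto_one (h3.congr' ?_)
  filter_upwards [eventually_gt_atTop 0] with m hm
  have hs : 0 < √(m : ℝ) := Real.sqrt_pos.mpr (by exact_mod_cast hm)
  have hn : 0 < √((2 * m + 1 : ℕ) : ℝ) := Real.sqrt_pos.mpr (by positivity)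
  simp only [Pi.div_apply]
  rw [Real.sqrt_mul (by positivity) ((2 * m + 1 : ℕ) : ℝ)]
  field_simp

end ParallelGW

theorem mainTheorem4 :
    -- a run that stops generates a binary tree, and its running time is the height of that tree
    (∀ (ω : ParallelGW.Bits) (n : ℕ), (ParallelGW.generated 1 ω).encard = n →
      ∃ τ : ParallelGW.BinTree, ParallelGW.size τ = n ∧
        ParallelGW.generated 1 ω = ParallelGW.nodeSet τ ∧
        ParallelGW.runningTime 1 ω = τ.height) ∧
    -- given its size, the generated tree is uniformly distributed
    (∀ τ : ParallelGW.BinTree,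
      (ParallelGW.condMeasure 1 (ParallelGW.size τ)).real
          {ω | ParallelGW.generated 1 ω = ParallelGW.nodeSet τ} =
        1 / ({σ : ParallelGW.BinTree | ParallelGW.size σ = ParallelGW.size τ}.ncard : ℝ)) ∧
    -- for size `n = 2 * m + 1`, the normalized running time converges in law to a Theta law
    (∀ x : ℝ, Tendsto
      (fun m : ℕ => (ParallelGW.condMeasure 1 (2 * m + 1)).real
        {ω | (ParallelGW.runningTime 1 ω : ℝ) /
          (2 * Real.sqrt (Real.pi * ((2 * m + 1 : ℕ) : ℝ))) ≤ x})
      atTop (𝓝 (ParallelGW.thetaCDF (Real.sqrt (2 * Real.pi) * x)))) ∧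
    -- the expected running time
    (fun m : ℕ => ∫ ω, (ParallelGW.runningTime 1 ω : ℝ) ∂(ParallelGW.condMeasure 1 (2 * m + 1)))
      ~[atTop] (fun m : ℕ => Real.sqrt (2 * Real.pi * ((2 * m + 1 : ℕ) : ℝ))) := by
  refine ⟨fun ω n h => ?_, fun τ => ?_, ParallelGW.tendsto_condMeasure_runningTime,
    ParallelGW.isEquivalent_integral_runningTime⟩
  · obtain ⟨τ, hτ⟩ := ParallelGW.exists_generated_eq_nodeSet (Set.finite_of_encard_eq_coe h)
    rw [hτ, ParallelGW.encard_nodeSet, Nat.cast_inj] at h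
    exact ⟨τ, h, hτ, ParallelGW.runningTime_eq_height hτ⟩
  · rw [← ParallelGW.treeProb_singleton]
    nth_rewrite 1 [ParallelGW.size_eq]
    refine ParallelGW.condMeasure_real_eq_treeProb fun σ _ ω hω => ?_
    rw [Set.mem_ofPred_eq, show ParallelGW.generated 1 ω = ParallelGW.nodeSet σ from hω]
    exact ParallelGW.nodeSet_injective.eq_iff
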